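/- Let $(t^1,t^2,z^1,z^2)$ be coordinates on $\mathbb R^4$, let $\mathcal G_2$ be the Abelian Lie algebra spanned by $\partial_{z^1},\partial_{z^2}$, and let $\mathfrak G$ be the pseudogroup of local smooth changes of coordinates that preserve $\mathcal G_2$, i.e. (locally) $\bar t^{\,i}=\phi^i(t)$, $\bar z^{\,i}=\alpha^i_j z^j+\psi^i(t)$ with $\phi,\psi$ smooth, $\det(\partial\phi^i/\partial t^j)\neq0$ and $(\alpha^i_j)\in \mathrm{GL}(2,\mathbb R)$ constant. It acts on the metrics $$\mathbf g=b_{ij}(t)\,dt^i dt^j+2f_{ik}(t)\,dt^i dz^k+h_{kl}(t)\,dz^k dz^l,\qquad b_{ij}=b_{ji},\ h_{kl}=h_{lk},$$ of arbitrary signature with $\det\mathbf g\ne0$ and $\det\mathbf h\neq 0$, where $\mathbf h=(h_{kl})$. Let $J^1\tau$ be the $34$-dimensional space of first-order jets of such metrics, with coordinates $t^i,z^k,b_{ij},f_{ik},h_{kl},b_{ij,s},f_{ik,s},h_{kl,s}$, where a comma denotes the (total) derivative with respect to $t^s$. A first-order scalar differential invariant on an open set $U\subseteq J^1\tau$ is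 a smooth function on $U$ that takes the same value at any two jets in $U$ related by the prolonged action of an element of $\mathfrak G$. Put $f_i^k=f_{is}h^{sk}$, $\tilde g_{ij}=b_{ij}-f_{ik}f_{jl}h^{kl}$, $\sigma=d(\det\mathbf h)/\det\mathbf h$, $\rho=\sigma^2$, $\chi=(dh_{11}\,dh_{22}-dh_{12}\,dh_{12})/\det\mathbf h$ (symmetric products), $\gamma=\chi-\frac14\rho$, and, for a symmetric form $\mu=\mu_{ij}dt^idt^j$, $C_\mu=\mu_{ij}\tilde g^{ij}$ and $Q_\mu=\det(\mu_{ij})/\det\tilde{\mathbf g}$. Put further $$\mathcal C^k=\frac{f^k_{1,2}-f^k_{2,1}}{\sqrt{|\det\tilde{\mathbf g}|}},\qquad \ell_{\mathcal C}=h_{kl}\,\mathcal C^k\mathcal C^l,\qquad \Theta_{\mathrm I}=\frac{1}{|\det\mathbf h|^{1/2}|\det\tilde{\mathbf g}|^{1/2}}\begin{vmatrix}h_{11,1}&h_{12,1}&h_{22,1}\\ h_{11,2}&h_{12,2}&h_{22,2}\\ (\mathcal C^2)^2&-\mathcal C^1\mathcal C^2&(\mathcal C^1)^2\end{vmatrix}.$$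 Then the six functions $C_\rho,\ C_\chi,\ Q_\chi,\ Q_\gamma,\ \ell_{\mathcal C},\ (\Theta_{\mathrm I})^2$ form a maximal system of generically functionally independent first-order scalar differential invariants in the orthogonally intransitive case. That is: 1. each of them is a first-order scalar differential invariant on $J^1\tau$; 2. their differentials are linearly independent (their Jacobian has rank $6$) at every point of an open dense subset of the set of orthogonally intransitive jets, i.e. of the jets in $J^1\tau$ at which the Ehresmann curvature $(f^k_{1,2}-f^k_{2,1})_{k=1,2}$ of the distribution orthogonal to the orbits of $\mathcal G_2$ is nonzero; 3. for every open $U\subseteq J^1\tau$ and every first-order scalar differential invariant $F$ on $U$, the seven functions $C_\rho,C_\chi,Q_\chi,Q_\gamma,\ell_{\mathcal C},(\Theta_{\mathrm I})^2,F$ have linearly dependent differentials at every point of $U$. -/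

import Mathlib

open scoped ContDiff

noncomputable section

namespace KillingJet

/-! ### Adapted coordinates and metrics -/

/-- The coordinate space of adapted coordinates `(t¹, t², z¹, z²)`:
`Sum.inl i` labels `tⁱ` and `Sum.inr k` labels `zᵏ`. -/
abbrev M : Type := Fin 2 ⊕ Fin 2 → ℝ

/-- The coordinates `(t¹, t²)` of a point; they are coordinates on the orbit space. -/
def tCoord (p : M) : Fin 2 → ℝ := fun i => p (Sum.inl i)

/-- The generators `∂/∂zᵏ` of the Abelian algebra `𝒢₂`. -/
def dz (k : Fin 2) : M := Pi.single (Sum.inr k) 1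

/-- The fibre coordinates `(b_{ij}, f_{ik}, h_{kl})` of the bundle `τ`. The families `b` and `h`
are indexed by unordered pairs, so that `b_{21} = b_{12}` and `h_{21} = h_{12}`; the fibre has
dimension `3 + 4 + 3 = 10`. -/
abbrev Coeff : Type :=
  (Sym2 (Fin 2) → ℝ) × (Fin 2 → Fin 2 → ℝ) × (Sym2 (Fin 2) → ℝ)

/-- The matrix `(b_{ij})`. -/
def bMat (c : Coeff) : Matrix (Fin 2) (Fin 2) ℝ := Matrix.of fun i j => c.1 s(i, j)

/-- The matrix `(f_{ik})`. -/
def fMat (c : Coeff) : Matrix (Fin 2) (Fin 2) ℝ := Matrix.of c.2.1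

/-- The matrix `(h_{kl})`. -/
def hMat (c : Coeff) : Matrix (Fin 2) (Fin 2) ℝ := Matrix.of fun k l => c.2.2 s(k, l)

/-- The component matrix of `𝐠 = b_{ij} dtⁱ dtʲ + 2 f_{ik} dtⁱ dzᵏ + h_{kl} dzᵏ dzˡ`. -/
def metric (c : Coeff) : Matrix (Fin 2 ⊕ Fin 2) (Fin 2 ⊕ Fin 2) ℝ :=
  Matrix.fromBlocks (bMat c) (fMat c) (fMat c).transpose (hMat c)

/-- The coefficients `f_i^k = f_{is} h^{sk}`. -/
def fUp (c : Coeff) : Matrix (Fin 2) (Fin 2) ℝ := fMat c * (hMat c)⁻¹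

/-- The orbit metric `g̃_{ij} = b_{ij} - f_{ik} f_{jl} h^{kl}`. -/
def orbitMetric (c : Coeff) : Matrix (Fin 2) (Fin 2) ℝ :=
  bMat c - fMat c * (hMat c)⁻¹ * (fMat c).transpose

/-! ### The pseudogroup of adapted coordinate transformations -/

/-- The Jacobian matrix `∂P^a/∂x^c` of a map `P` of the coordinate space. -/
def jacobian (P : M → M) (p : M) : Matrix (Fin 2 ⊕ Fin 2) (Fin 2 ⊕ Fin 2) ℝ :=
  Matrix.of fun a c => fderiv ℝ P p (Pi.single c 1) a

/-- `P`, with domain `W`, is an element of the pseudogroup `𝔊`: a smooth change of coordinates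
under which the algebra `𝒢₂` generated by `∂/∂z¹, ∂/∂z²` is the algebra generated by
`∂/∂z̄¹, ∂/∂z̄²`, that is, `∂/∂zʲ = αⁱⱼ ∂/∂z̄ⁱ` for a constant invertible matrix `α`.
(It follows that locally `t̄ = φ(t)` and `z̄ = α z + ψ(t)`; in particular the leaves
`t = const` are mapped into the leaves `t̄ = const`.) -/
structure IsAdaptedTransformation (P : M → M) (W : Set M) : Prop where
  isOpen : IsOpen W
  contDiffOn : ContDiffOn ℝ ∞ P W
  injOn : Set.InjOn P W
  det_ne_zero : ∀ p ∈ W, (jacobian P p).det ≠ 0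
  preserves : ∃ α : Matrix (Fin 2) (Fin 2) ℝ, α.det ≠ 0 ∧
    ∀ p ∈ W, ∀ j, fderiv ℝ P p (dz j) = ∑ i, α i j • dz i

/-- The fields of coefficients `s` and `s'` (functions of `t` only, i.e. sections of `τ`), smooth
over `W` and `P W` respectively, are such that `P` carries the metric of `s` on `W` into the metric
of `s'`: the first metric is the pull-back of the second one along `P`. -/
structure Transforms (P : M → M) (W : Set M) (s s' : (Fin 2 → ℝ) → Coeff) : Prop where
  smooth : ∀ p ∈ W, ContDiffAt ℝ ∞ s (tCoord p)
  smooth' : ∀ p ∈ W, ContDiffAt ℝ ∞ s' (tCoord (P p))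
  pullback : ∀ p ∈ W, metric (s (tCoord p)) =
    (jacobian P p).transpose * metric (s' (tCoord (P p))) * jacobian P p

/-! ### First-order jets -/

/-- First-order jets of sections of `τ`: the base point `(t, z)`, the coefficients
`(b_{ij}, f_{ik}, h_{kl})`, and their first derivatives `(b_{ij,s}, f_{ik,s}, h_{kl,s})` with
respect to `tˢ`. The dimension is `4 + 10 + 20 = 34`. -/
abbrev Jet : Type := M × Coeff × (Fin 2 → Coeff)

/-- The coefficients `(b_{ij}, f_{ik}, h_{kl})` at a jet. -/
def coeff (x : Jet) : Coeff := x.2.1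

/-- The `1`-jet at `p` of the section with coefficients `s`. -/
def jetOf (s : (Fin 2 → ℝ) → Coeff) (p : M) : Jet :=
  (p, s (tCoord p), fun i => fderiv ℝ s (tCoord p) (Pi.single i 1))

/-- The total derivative `D_s φ` of a function `φ` of the coefficients, a function on jets. -/
def totalDeriv (s : Fin 2) (φ : Coeff → ℝ) (x : Jet) : ℝ := fderiv ℝ φ (coeff x) (x.2.2 s)

/-- `J¹τ`: the jets of metrics that are nondegenerate and whose restriction to the Killing leaves
is nondegenerate. -/
def J1 : Set Jet := {x | (metric (coeff x)).det ≠ 0 ∧ (hMat (coeff x)).det ≠ 0}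

/-- A first-order scalar differential invariant with domain `U`: a smooth function on `U` that is
invariant under the first prolongation of the action of the pseudogroup. -/
structure IsInvariant (U : Set Jet) (F : Jet → ℝ) : Prop where
  smooth : ContDiffOn ℝ ∞ F U
  invariant : ∀ (P : M → M) (W : Set M) (s s' : (Fin 2 → ℝ) → Coeff),
    IsAdaptedTransformation P W → Transforms P W s s' →
      ∀ p ∈ W, jetOf s p ∈ U → jetOf s' (P p) ∈ U → F (jetOf s' (P p)) = F (jetOf s p)

/-! ### The invariants -/

/-- `det 𝐡` at a jet. -/
def detH (x : Jet) : ℝ := (hMat (coeff x)).det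

/-- `det g̃` at a jet. -/
def detG (x : Jet) : ℝ := (orbitMetric (coeff x)).det

/-- `h_{kl,s}`. -/
def dh (s k l : Fin 2) (x : Jet) : ℝ := totalDeriv s (fun c => hMat c k l) x

/-- The components of the form `σ = d(det 𝐡) / det 𝐡`. -/
def sigma (x : Jet) (i : Fin 2) : ℝ := totalDeriv i (fun c => (hMat c).det) x / detH x

/-- The symmetric form `ρ = σ²`. -/
def rho (x : Jet) : Matrix (Fin 2) (Fin 2) ℝ := Matrix.of fun i j => sigma x i * sigma x j

/-- The symmetric form `χ = (dh₁₁ dh₂₂ - dh₁₂ dh₁₂) / det 𝐡`. -/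
def chi (x : Jet) : Matrix (Fin 2) (Fin 2) ℝ := Matrix.of fun i j =>
  (1 / (2 * detH x)) * (dh i 0 0 x * dh j 1 1 x - dh j 0 1 x * dh i 0 1 x) +
  (1 / (2 * detH x)) * (dh j 0 0 x * dh i 1 1 x - dh i 0 1 x * dh j 0 1 x)

/-- The Cosgrove form `γ = χ - ρ / 4`. -/
def gam (x : Jet) : Matrix (Fin 2) (Fin 2) ℝ := chi x - (1 / 4 : ℝ) • rho x

/-- `C_μ = μ_{ij} g̃^{ij}`. -/
def traceInv (μ : Jet → Matrix (Fin 2) (Fin 2) ℝ) (x : Jet) : ℝ :=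
  ∑ i, ∑ j, μ x i j * (orbitMetric (coeff x))⁻¹ i j

/-- `Q_μ = det μ / det g̃`. -/
def detInv (μ : Jet → Matrix (Fin 2) (Fin 2) ℝ) (x : Jet) : ℝ := (μ x).det / detG x

/-- The Ehresmann curvature of the horizontal distribution `Ξ^⊥`, spanned by
`𝐞_j = ∂/∂tʲ - f_j^k ∂/∂zᵏ`: the components
`D₂ f_1^k - D₁ f_2^k` of `𝐜(∂/∂t¹, ∂/∂t²) = [𝐞₁, 𝐞₂]`. -/
def ehresmann (x : Jet) (k : Fin 2) : ℝ :=
  totalDeriv 1 (fun c => fUp c 0 k) x - totalDeriv 0 (fun c => fUp c 1 k) x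

/-- The components `𝒞ᵏ` of the curvature vector field. -/
def curv (x : Jet) (k : Fin 2) : ℝ := ehresmann x k / Real.sqrt |detG x|

/-- `ℓ_𝒞 = 𝐠(𝒞, 𝒞)`. -/
def ellC (x : Jet) : ℝ := ∑ k, ∑ l, hMat (coeff x) k l * curv x k * curv x l

/-- The semi-invariant `Θ_I`. -/
def thetaI (x : Jet) : ℝ :=
  1 / (Real.sqrt |detH x| * Real.sqrt |detG x|) *
    Matrix.det !![dh 0 0 0 x, dh 0 0 1 x, dh 0 1 1 x;
                  dh 1 0 0 x, dh 1 0 1 x, dh 1 1 1 x;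
                  (curv x 1) ^ 2, -(curv x 0 * curv x 1), (curv x 0) ^ 2]

/-- The system `C_ρ, C_χ, Q_χ, Q_γ, ℓ_𝒞, (Θ_I)²`. -/
def invariants : Fin 6 → Jet → ℝ :=
  ![traceInv rho, traceInv chi, detInv chi, detInv gam, ellC, fun x => thetaI x ^ 2]

/-! ### The orthogonally intransitive case and functional independence -/

/-- The jets in `J¹τ` with nonvanishing Ehresmann curvature, i.e. the jets at which the obstruction
to the integrability of `Ξ^⊥` does not vanish. -/
def intransitiveJ1 : Set Jet := {x | x ∈ J1 ∧ ehresmann x ≠ 0}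

/-- Functional independence at a jet: the differentials of the functions are linearly independent
there, i.e. the Jacobian of the family has rank equal to the number of functions. -/
def FunctionallyIndependentAt {n : ℕ} (F : Fin n → Jet → ℝ) (x : Jet) : Prop :=
  LinearIndependent ℝ fun i => fderiv ℝ (F i) x

/-- Generic functional independence on a set of jets: functional independence at every jet of an
open dense subset. -/
def GenericallyIndependentOn {n : ℕ} (F : Fin n → Jet → ℝ) (U : Set Jet) : Prop :=
  ∃ R : Set Jet, IsOpen R ∧ R ⊆ U ∧ U ⊆ closure R ∧ ∀ x ∈ R, FunctionallyIndependentAt F x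

end KillingJet

end

/-!
An adapted transformation with Jacobian blocks `a = ∂φ/∂t` and `α` acts on the orbit metric `g̃`, on
`𝐡`, on the derivatives of `𝐡` and on the Ehresmann curvature `c` by the linear substitutions `a`
and `α` alone: the second derivatives of the transformation cancel. The six functions are
expressions in these reduced data which are built from determinants and their polarizations, and
the powers of `det a` and `det α` which they pick up compensate.

An upper bound for the number of independent invariants comes from the orbits. To first order, a
transformation acts on a `1`-jet through its own `2`-jet, and these form a space of dimension `28`.
The differential of the resulting orbit map is injective wherever `Θ_I ≠ 0`: a tangent vector in its
kernel fixes `g̃`, `𝐡`, the derivatives of `𝐡` and `c`, which leaves only trivial first derivatives,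
and then, as for an infinitesimal isometry of a nondegenerate metric, the second derivatives vanish.
The orbits therefore have dimension `28` in the `34`-dimensional `J¹τ`, and at most `34 - 28 = 6`
invariants are independent.

For the independence of the six, vary `c` and the derivatives of `𝐡` along the fibres. Varying `c`
separates `ℓ_𝒞` and `(Θ_I)²` from the others, which do not involve it. The derivatives of `𝐡` split
into their trace `σ` and a trace-free part, which carries `γ`, and varying these independently
separates the remaining four. The genericity conditions used amount to the nonvanishing of one
polynomial in the jet, hence hold on a dense open set.
-/

noncomputable section

namespace KillingJet

open Matrix
open scoped Matrix.Norms.Operator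

/-- Square matrices of size two. -/
abbrev Mat2 : Type := Matrix (Fin 2) (Fin 2) ℝ

/-- Square matrices of size four, in the block form adapted to `(t¹, t² | z¹, z²)`. -/
abbrev Mat4 : Type := Matrix (Fin 2 ⊕ Fin 2) (Fin 2 ⊕ Fin 2) ℝ

/-! ### Calculus of matrices -/

section MatrixCalculus

variable {𝕜 ι : Type*} [RCLike 𝕜] [Fintype ι] {n : WithTop ℕ∞}

lemma contDiff_matrix_apply (i j : ι) : ContDiff 𝕜 n fun m : Matrix ι ι 𝕜 => m i j :=
  (entryLinearMap 𝕜 𝕜 i j).toContinuousLinearMap.contDiff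

lemma contDiff_matrix_transpose : ContDiff 𝕜 n (transpose : Matrix ι ι 𝕜 → Matrix ι ι 𝕜) :=
  (transposeLinearEquiv ι ι 𝕜 𝕜).toLinearMap.toContinuousLinearMap.contDiff

variable [DecidableEq ι]

lemma contDiff_matrix_det : ContDiff 𝕜 n (det : Matrix ι ι 𝕜 → 𝕜) := by
  simp only [funext det_apply]
  exact ContDiff.sum fun τ _ =>
    (contDiff_prod fun i _ => contDiff_matrix_apply (τ i) i).const_smul _

lemma hasFDerivAt_matrix_inv {m : Matrix ι ι 𝕜} (hm : m.det ≠ 0) :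
    HasFDerivAt Inv.inv (-ContinuousLinearMap.mulLeftRight 𝕜 (Matrix ι ι 𝕜) m⁻¹ m⁻¹) m := by
  obtain ⟨u, rfl⟩ := (isUnit_iff_isUnit_det m).mpr hm.isUnit
  rw [← coe_units_inv, show Inv.inv = Ring.inverse from funext nonsing_inv_eq_ringInverse]
  exact hasFDerivAt_ringInverse u

lemma contDiffAt_matrix_inv {m : Matrix ι ι 𝕜} (hm : m.det ≠ 0) : ContDiffAt 𝕜 n Inv.inv m := by
  obtain ⟨u, rfl⟩ := (isUnit_iff_isUnit_det m).mpr hm.isUnit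
  rw [show Inv.inv = Ring.inverse from funext nonsing_inv_eq_ringInverse]
  exact contDiffAt_ringInverse 𝕜 u

end MatrixCalculus

/-! ### Metrics and their coefficients -/

/-- `bMat` as a continuous linear map. -/
def bMatL : Coeff →L[ℝ] Mat2 :=
  LinearMap.toContinuousLinearMap ⟨⟨bMat, fun _ _ => rfl⟩, fun _ _ => rfl⟩

/-- `fMat` as a continuous linear map. -/
def fMatL : Coeff →L[ℝ] Mat2 :=
  LinearMap.toContinuousLinearMap ⟨⟨fMat, fun _ _ => rfl⟩, fun _ _ => rfl⟩

/-- `hMat` as a continuous linear map. -/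
def hMatL : Coeff →L[ℝ] Mat2 :=
  LinearMap.toContinuousLinearMap ⟨⟨hMat, fun _ _ => rfl⟩, fun _ _ => rfl⟩

lemma metric_add (c d : Coeff) : metric (c + d) = metric c + metric d :=
  (fromBlocks_add ..).symm

lemma metric_smul (r : ℝ) (c : Coeff) : metric (r • c) = r • metric c :=
  (fromBlocks_smul ..).symm

/-- `metric` as a continuous linear map. -/
def metricL : Coeff →L[ℝ] Mat4 :=
  LinearMap.toContinuousLinearMap ⟨⟨metric, metric_add⟩, metric_smul⟩

/-- The coefficients of the symmetric part of a bilinear form on the coordinate space; on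
symmetric matrices this inverts `metric`. -/
def ofMat (m : Mat4) : Coeff :=
  (Sym2.lift ⟨fun i j => (m (.inl i) (.inl j) + m (.inl j) (.inl i)) / 2,
      fun _ _ => congrArg (· / 2) (add_comm _ _)⟩,
    fun i k => (m (.inl i) (.inr k) + m (.inr k) (.inl i)) / 2,
    Sym2.lift ⟨fun k l => (m (.inr k) (.inr l) + m (.inr l) (.inr k)) / 2,
      fun _ _ => congrArg (· / 2) (add_comm _ _)⟩)

lemma metric_ofMat_add_self (m : Mat4) : metric (ofMat m) = (2⁻¹ : ℝ) • (m + mᵀ) := by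
  ext (i | i) (j | j) <;> simp [metric, ofMat, bMat, fMat, hMat] <;> ring

lemma metric_ofMat {m : Mat4} (hm : mᵀ = m) : metric (ofMat m) = m := by
  rw [metric_ofMat_add_self, hm, ← two_smul ℝ m, smul_smul]
  norm_num

lemma bMat_transpose (c : Coeff) : (bMat c)ᵀ = bMat c := by
  ext i j
  simp only [transpose_apply, bMat, of_apply, Sym2.eq_swap]

lemma hMat_transpose (c : Coeff) : (hMat c)ᵀ = hMat c := by
  ext i j
  simp only [transpose_apply, hMat, of_apply, Sym2.eq_swap]

lemma metric_transpose (c : Coeff) : (metric c)ᵀ = metric c := by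
  simp only [metric, fromBlocks_transpose, bMat_transpose, hMat_transpose, transpose_transpose]

lemma metric_injective : Function.Injective metric := by
  intro c d h
  obtain ⟨hb, hf, -, hh⟩ := fromBlocks_inj.mp h
  refine Prod.ext ?_ (Prod.ext hf ?_)
  · ext z
    induction z with | _ i j => exact congr_fun₂ hb i j
  · ext z
    induction z with | _ i j => exact congr_fun₂ hh i j

/-- `ofMat` as a continuous linear map. -/
def ofMatL : Mat4 →L[ℝ] Coeff := LinearMap.toContinuousLinearMap
  { toFun := ofMat
    map_add' := fun m n => metric_injective (by
      simp only [metric_add, metric_ofMat_add_self, transpose_add, smul_add]; abel)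
    map_smul' := fun r m => metric_injective (by
      simp only [metric_smul, metric_ofMat_add_self, transpose_smul, RingHom.id_apply, ← smul_add,
        smul_comm r]) }

lemma orbitMetric_transpose (c : Coeff) : (orbitMetric c)ᵀ = orbitMetric c := by
  simp only [orbitMetric, transpose_sub, transpose_mul, transpose_transpose, transpose_nonsing_inv,
    bMat_transpose, hMat_transpose, Matrix.mul_assoc]

lemma det_metric {c : Coeff} (hc : (hMat c).det ≠ 0) :
    (metric c).det = (hMat c).det * (orbitMetric c).det := by
  have : Invertible (hMat c) := invertibleOfIsUnitDet _ hc.isUnit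
  rw [metric, det_fromBlocks₂₂, invOf_eq_nonsing_inv, orbitMetric]

lemma fUp_mul_hMat {c : Coeff} (hc : (hMat c).det ≠ 0) : fUp c * hMat c = fMat c := by
  rw [fUp, nonsing_inv_mul_cancel_right _ _ hc.isUnit]

lemma orbitMetric_eq_fUp {c : Coeff} (hc : (hMat c).det ≠ 0) :
    orbitMetric c = bMat c - fUp c * hMat c * (fUp c)ᵀ := by
  rw [fUp_mul_hMat hc, fUp, transpose_mul, transpose_nonsing_inv, hMat_transpose, orbitMetric,
    Matrix.mul_assoc]

lemma contDiff_det_hMat {n : WithTop ℕ∞} : ContDiff ℝ n fun c => (hMat c).det :=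
  contDiff_matrix_det.comp hMatL.contDiff

lemma contDiffAt_fUp {n : WithTop ℕ∞} {c : Coeff} (hc : (hMat c).det ≠ 0) :
    ContDiffAt ℝ n fUp c :=
  fMatL.contDiff.contDiffAt.mul ((contDiffAt_matrix_inv hc).comp c hMatL.contDiff.contDiffAt)

lemma contDiffAt_orbitMetric {n : WithTop ℕ∞} {c : Coeff} (hc : (hMat c).det ≠ 0) :
    ContDiffAt ℝ n orbitMetric c :=
  bMatL.contDiff.contDiffAt.sub
    ((contDiffAt_fUp hc).mul (contDiff_matrix_transpose.comp fMatL.contDiff).contDiffAt)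

lemma isOpen_J1 : IsOpen J1 := by
  have h_metric : Continuous fun x : Jet => (metric (coeff x)).det :=
    (metricL.continuous.comp continuous_snd.fst).matrix_det
  have h_hMat : Continuous fun x : Jet => (hMat (coeff x)).det :=
    (hMatL.continuous.comp continuous_snd.fst).matrix_det
  exact (isOpen_ne_fun h_metric continuous_const).inter (isOpen_ne_fun h_hMat continuous_const)

/-! ### Algebra of binary quadratic forms -/

section BinaryForms

variable {R : Type*} [CommRing R]

/-- The area form of the plane. -/
def cross (u v : Fin 2 → R) : R := u 0 * v 1 - u 1 * v 0

lemma cross_self (u : Fin 2 → R) : cross u u = 0 := by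
  rw [cross, mul_comm, sub_self]

lemma cross_add_left (u v w : Fin 2 → R) : cross (u + v) w = cross u w + cross v w := by
  simp only [cross, Pi.add_apply]; ring

lemma cross_add_right (u v w : Fin 2 → R) : cross u (v + w) = cross u v + cross u w := by
  simp only [cross, Pi.add_apply]; ring

lemma cross_smul_left (r : R) (u v : Fin 2 → R) : cross (r • u) v = r * cross u v := by
  simp only [cross, Pi.smul_apply, smul_eq_mul]; ring

lemma cross_smul_right (r : R) (u v : Fin 2 → R) : cross u (r • v) = r * cross u v := by
  simp only [cross, Pi.smul_apply, smul_eq_mul]; ring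

lemma cross_mulVec (A : Matrix (Fin 2) (Fin 2) R) (u v : Fin 2 → R) :
    cross (A *ᵥ u) (A *ᵥ v) = A.det * cross u v := by
  simp only [cross, mulVec, dotProduct, Fin.sum_univ_two, det_fin_two]; ring

lemma det_eq_cross_mulVec (m n : Matrix (Fin 2) (Fin 2) R) (hm : mᵀ = m) (hn : nᵀ = n)
    (u : Fin 2 → R) :
    det !![m 0 0, m 0 1, m 1 1; n 0 0, n 0 1, n 1 1; u 1 ^ 2, -(u 0 * u 1), u 0 ^ 2] =
      cross (m *ᵥ u) (n *ᵥ u) := by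
  have hm' : m 1 0 = m 0 1 := congr_fun₂ hm 0 1
  have hn' : n 1 0 = n 0 1 := congr_fun₂ hn 0 1
  simp [det_fin_three, cross, mulVec, dotProduct, Fin.sum_univ_two, hm', hn']
  ring

/-- The polarization of the determinant of `2 × 2` matrices, normalized by
`detPolar m m = 2 * det m`. -/
def detPolar (m n : Matrix (Fin 2) (Fin 2) R) : R := (adjugate m * n).trace

lemma detPolar_eq (m n : Matrix (Fin 2) (Fin 2) R) :
    detPolar m n = m 0 0 * n 1 1 + m 1 1 * n 0 0 - m 0 1 * n 1 0 - m 1 0 * n 0 1 := by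
  simp only [detPolar, adjugate_fin_two, trace_fin_two, mul_apply, Fin.sum_univ_two, of_apply,
    cons_val_zero, cons_val_one, cons_val', cons_val_fin_one]
  ring

lemma detPolar_comm (m n : Matrix (Fin 2) (Fin 2) R) : detPolar m n = detPolar n m := by
  simp only [detPolar_eq]; ring

lemma detPolar_self (m : Matrix (Fin 2) (Fin 2) R) : detPolar m m = 2 * m.det := by
  rw [detPolar_eq, det_fin_two]; ring

lemma detPolar_add_right (m n p : Matrix (Fin 2) (Fin 2) R) :
    detPolar m (n + p) = detPolar m n + detPolar m p := by
  simp only [detPolar, Matrix.mul_add, trace_add]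

lemma detPolar_smul_right (m n : Matrix (Fin 2) (Fin 2) R) (r : R) :
    detPolar m (r • n) = r * detPolar m n := by
  simp only [detPolar, Matrix.mul_smul, trace_smul, smul_eq_mul]

lemma detPolar_add_left (m n p : Matrix (Fin 2) (Fin 2) R) :
    detPolar (m + n) p = detPolar m p + detPolar n p := by
  simp only [detPolar_comm _ p, detPolar_add_right]

lemma detPolar_smul_left (m n : Matrix (Fin 2) (Fin 2) R) (r : R) :
    detPolar (r • m) n = r * detPolar m n := by
  simp only [detPolar_comm _ n, detPolar_smul_right]

lemma detPolar_vecMulVec (m : Matrix (Fin 2) (Fin 2) R) (u v : Fin 2 → R) :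
    detPolar m (vecMulVec u v) = v ⬝ᵥ adjugate m *ᵥ u := by
  rw [detPolar, mul_vecMulVec, trace_vecMulVec, dotProduct_comm]

lemma detPolar_congr (A m n : Matrix (Fin 2) (Fin 2) R) :
    detPolar (Aᵀ * m * A) (Aᵀ * n * A) = A.det ^ 2 * detPolar m n := by
  simp only [detPolar_eq, mul_apply, transpose_apply, Fin.sum_univ_two, det_fin_two]; ring

end BinaryForms

/-! ### The invariants in terms of reduced data -/

section ReducedInvariants

variable (g h : Mat2) (k : Fin 2 → Mat2) (c : Fin 2 → ℝ)

/-- The form `σ` of a matrix `h` with partial derivatives `k`. -/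
def logDetForm (i : Fin 2) : ℝ := detPolar h (k i) / h.det

/-- The form `χ` of a matrix `h` with partial derivatives `k`. -/
def chiForm : Mat2 := of fun i j => detPolar (k i) (k j) / (2 * h.det)

/-- The Cosgrove form `γ` of a matrix `h` with partial derivatives `k`. -/
def cosgroveForm : Mat2 :=
  chiForm h k - (1 / 4 : ℝ) • vecMulVec (logDetForm h k) (logDetForm h k)

/-- The invariants, as functions of the orbit metric `g`, of `h = 𝐡`, of its partial derivatives
`k`, and of the Ehresmann curvature `c`. -/
def reducedInvariants : Fin 6 → ℝ :=
  ![detPolar g (vecMulVec (logDetForm h k) (logDetForm h k)) / g.det,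
    detPolar g (chiForm h k) / g.det,
    (chiForm h k).det / g.det,
    (cosgroveForm h k).det / g.det,
    (c ⬝ᵥ h *ᵥ c) / |g.det|,
    cross (k 0 *ᵥ c) (k 1 *ᵥ c) ^ 2 / (|h.det| * |g.det| ^ 3)]

variable (A : Mat2) {α : Mat2}

lemma logDetForm_congr (hα : α.det ≠ 0) :
    logDetForm (αᵀ * h * α) (fun s => αᵀ * (∑ r, A r s • k r) * α) = Aᵀ *ᵥ logDetForm h k := by
  ext i
  simp only [logDetForm, detPolar_congr, det_mul, det_transpose, mulVec, dotProduct,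
    Fin.sum_univ_two, transpose_apply, detPolar_add_right, detPolar_smul_right]
  field_simp

lemma chiForm_congr (hα : α.det ≠ 0) :
    chiForm (αᵀ * h * α) (fun s => αᵀ * (∑ r, A r s • k r) * α) = Aᵀ * chiForm h k * A := by
  ext i j
  simp only [chiForm, of_apply, detPolar_congr, det_mul, det_transpose, mul_apply, Fin.sum_univ_two,
    transpose_apply, detPolar_add_right, detPolar_smul_right, detPolar_add_left,
    detPolar_smul_left, detPolar_comm (k 1) (k 0)]
  field_simp

lemma vecMulVec_transpose_mulVec (u v : Fin 2 → ℝ) :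
    vecMulVec (Aᵀ *ᵥ u) (Aᵀ *ᵥ v) = Aᵀ * vecMulVec u v * A := by
  rw [mul_vecMulVec, vecMulVec_mul, mulVec_transpose, mulVec_transpose]

lemma cosgroveForm_congr (hα : α.det ≠ 0) :
    cosgroveForm (αᵀ * h * α) (fun s => αᵀ * (∑ r, A r s • k r) * α) =
      Aᵀ * cosgroveForm h k * A := by
  simp only [cosgroveForm, logDetForm_congr h k A hα, chiForm_congr h k A hα,
    vecMulVec_transpose_mulVec, Matrix.mul_sub, Matrix.sub_mul, Matrix.mul_smul, Matrix.smul_mul]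

lemma dotProduct_congr_mulVec (u : Fin 2 → ℝ) :
    u ⬝ᵥ (αᵀ * h * α) *ᵥ u = (α *ᵥ u) ⬝ᵥ h *ᵥ (α *ᵥ u) := by
  rw [Matrix.mul_assoc, ← mulVec_mulVec, ← mulVec_mulVec, dotProduct_mulVec, vecMul_transpose]

lemma cross_sum_smul (u : Fin 2 → Fin 2 → ℝ) :
    cross (∑ r, A r 0 • u r) (∑ r, A r 1 • u r) = A.det * cross (u 0) (u 1) := by
  simp only [cross, Finset.sum_apply, Pi.smul_apply, smul_eq_mul, Fin.sum_univ_two, det_fin_two]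
  ring

lemma cross_congr_mulVec (u : Fin 2 → ℝ) :
    cross ((αᵀ * (∑ r, A r 0 • k r) * α) *ᵥ u) ((αᵀ * (∑ r, A r 1 • k r) * α) *ᵥ u) =
      α.det * (A.det * cross (k 0 *ᵥ α *ᵥ u) (k 1 *ᵥ α *ᵥ u)) := by
  simp only [Matrix.mul_assoc, ← mulVec_mulVec, cross_mulVec, det_transpose, sum_mulVec,
    smul_mulVec]
  rw [cross_sum_smul A fun r => k r *ᵥ α *ᵥ u]

variable {A} {c}

theorem reducedInvariants_congr (hA : A.det ≠ 0) (hα : α.det ≠ 0) {c' : Fin 2 → ℝ}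
    (hc : α *ᵥ c = A.det • c') :
    reducedInvariants (Aᵀ * g * A) (αᵀ * h * α) (fun s => αᵀ * (∑ r, A r s • k r) * α) c =
      reducedInvariants g h k c' := by
  have h_ell : c ⬝ᵥ (αᵀ * h * α) *ᵥ c = A.det ^ 2 * (c' ⬝ᵥ h *ᵥ c') := by
    rw [dotProduct_congr_mulVec, hc]
    simp only [mulVec_smul, smul_dotProduct, dotProduct_smul, smul_eq_mul]
    ring
  have h_theta : cross ((αᵀ * (∑ r, A r 0 • k r) * α) *ᵥ c)
      ((αᵀ * (∑ r, A r 1 • k r) * α) *ᵥ c) =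
        α.det * A.det ^ 3 * cross (k 0 *ᵥ c') (k 1 *ᵥ c') := by
    rw [cross_congr_mulVec, hc]
    simp only [mulVec_smul, cross_smul_left, cross_smul_right]
    ring
  have h_det (B m : Mat2) : (Bᵀ * m * B).det = |B.det| ^ 2 * m.det := by
    rw [det_mul, det_mul, det_transpose, sq_abs]; ring
  have hA_abs := abs_ne_zero.mpr hA
  have hα_abs := abs_ne_zero.mpr hα
  unfold reducedInvariants
  rw [h_ell, h_theta, chiForm_congr h k A hα, cosgroveForm_congr h k A hα,
    logDetForm_congr h k A hα, vecMulVec_transpose_mulVec]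
  simp only [detPolar_congr, h_det A, h_det α, ← sq_abs A.det, ← sq_abs (α.det * _ * _),
    ← sq_abs (cross _ _), abs_mul, abs_pow, abs_abs, mul_pow]
  ext i
  fin_cases i <;> dsimp <;> field_simp

end ReducedInvariants

/-- The total derivative `D_s f_i^k`, from differentiating `f_i^k h_{kl} = f_{il}`. -/
def dfUp (s : Fin 2) (x : Jet) : Mat2 :=
  (fMat (x.2.2 s) - fUp (coeff x) * hMat (x.2.2 s)) * (hMat (coeff x))⁻¹

lemma dfUp_mul_hMat {x : Jet} (hx : (hMat (coeff x)).det ≠ 0) (s : Fin 2) :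
    dfUp s x * hMat (coeff x) + fUp (coeff x) * hMat (x.2.2 s) = fMat (x.2.2 s) := by
  rw [dfUp, nonsing_inv_mul_cancel_right _ _ hx.isUnit, sub_add_cancel]

lemma totalDeriv_fUp {x : Jet} (hx : (hMat (coeff x)).det ≠ 0) (s i k : Fin 2) :
    totalDeriv s (fun c => fUp c i k) x = dfUp s x i k := by
  have h_inv : HasFDerivAt (fun c => (hMat c)⁻¹) _ (coeff x) :=
    (hasFDerivAt_matrix_inv hx).comp _ hMatL.hasFDerivAt
  have h_fUp : HasFDerivAt fUp _ (coeff x) := fMatL.hasFDerivAt.mul' h_inv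
  have h_entry : HasFDerivAt (fun c => fUp c i k) _ (coeff x) :=
    (entryLinearMap ℝ ℝ i k).toContinuousLinearMap.hasFDerivAt.comp _ h_fUp
  rw [totalDeriv, h_entry.fderiv]
  change (fMat (coeff x) * -((hMat (coeff x))⁻¹ * hMat (x.2.2 s) * (hMat (coeff x))⁻¹) +
    fMat (x.2.2 s) * (hMat (coeff x))⁻¹) i k = _
  simp only [dfUp, fUp, Matrix.sub_mul, Matrix.mul_neg, Matrix.mul_assoc, neg_add_eq_sub]

lemma ehresmann_eq {x : Jet} (hx : (hMat (coeff x)).det ≠ 0) :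
    ehresmann x = dfUp 1 x 0 - dfUp 0 x 1 := by
  ext k
  simp only [ehresmann, totalDeriv_fUp hx, Pi.sub_apply]

lemma dh_eq (s k l : Fin 2) (x : Jet) : dh s k l x = hMat (x.2.2 s) k l := by
  have h_entry : HasFDerivAt (fun c => hMat c k l) _ (coeff x) :=
    ((entryLinearMap ℝ ℝ k l).toContinuousLinearMap.comp hMatL).hasFDerivAt
  rw [dh, totalDeriv, h_entry.fderiv]
  rfl

lemma sigma_eq (x : Jet) :
    sigma x = logDetForm (hMat (coeff x)) fun s => hMat (x.2.2 s) := by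
  have h_entry (k l : Fin 2) : HasFDerivAt (fun c => hMat c k l) _ (coeff x) :=
    ((entryLinearMap ℝ ℝ k l).toContinuousLinearMap.comp hMatL).hasFDerivAt
  have h_det : HasFDerivAt (fun c => (hMat c).det) _ (coeff x) :=
    (((h_entry 0 0).mul (h_entry 1 1)).sub ((h_entry 0 1).mul (h_entry 1 0))).congr_of_eventuallyEq
      (.of_forall fun c => det_fin_two _)
  ext i
  rw [sigma, totalDeriv, h_det.fderiv, logDetForm, detPolar_eq, detH]
  congr 1
  change _ * hMat (x.2.2 i) 1 1 + _ * hMat (x.2.2 i) 0 0 -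
    (_ * hMat (x.2.2 i) 1 0 + _ * hMat (x.2.2 i) 0 1) = _
  ring

lemma rho_eq (x : Jet) : rho x = vecMulVec (sigma x) (sigma x) := rfl

lemma chi_eq (x : Jet) :
    chi x = chiForm (hMat (coeff x)) fun s => hMat (x.2.2 s) := by
  ext i j
  have h_symm (s : Fin 2) : hMat (x.2.2 s) 1 0 = hMat (x.2.2 s) 0 1 :=
    congr_fun₂ (hMat_transpose _) 0 1
  simp only [chi, dh_eq, chiForm, detPolar_eq, h_symm, of_apply, detH]
  ring

lemma gam_eq (x : Jet) :
    gam x = cosgroveForm (hMat (coeff x)) fun s => hMat (x.2.2 s) := by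
  rw [gam, cosgroveForm, chi_eq, rho_eq, sigma_eq]

lemma traceInv_eq (μ : Jet → Mat2) (x : Jet) :
    traceInv μ x = detPolar (orbitMetric (coeff x)) (μ x) / detG x := by
  have h_symm : orbitMetric (coeff x) 1 0 = orbitMetric (coeff x) 0 1 :=
    congr_fun₂ (orbitMetric_transpose _) 0 1
  simp only [traceInv, inv_def, Ring.inverse_eq_inv', adjugate_fin_two, detPolar_eq, detG,
    Fin.sum_univ_two, Matrix.smul_apply, of_apply, cons_val', cons_val_zero, cons_val_one,
    cons_val_fin_one, smul_eq_mul, h_symm]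
  ring

lemma ellC_eq (x : Jet) :
    ellC x = ehresmann x ⬝ᵥ hMat (coeff x) *ᵥ ehresmann x / |detG x| := by
  have h_sqrt : √|detG x| ^ 2 = |detG x| := Real.sq_sqrt (abs_nonneg _)
  simp only [ellC, curv, dotProduct, mulVec, Fin.sum_univ_two]
  generalize √|detG x| = r at h_sqrt ⊢
  rw [← h_sqrt]
  ring

lemma thetaI_sq_eq (x : Jet) : thetaI x ^ 2 =
    cross (hMat (x.2.2 0) *ᵥ ehresmann x) (hMat (x.2.2 1) *ᵥ ehresmann x) ^ 2 /
      (|detH x| * |detG x| ^ 3) := by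
  have h_sqrtG : √|detG x| ^ 2 = |detG x| := Real.sq_sqrt (abs_nonneg _)
  have h_sqrtH : √|detH x| ^ 2 = |detH x| := Real.sq_sqrt (abs_nonneg _)
  rw [thetaI]
  simp only [dh_eq, det_eq_cross_mulVec _ _ (hMat_transpose _) (hMat_transpose _)]
  simp only [curv, cross, dotProduct, mulVec, Fin.sum_univ_two]
  generalize √|detG x| = r at h_sqrtG ⊢
  generalize √|detH x| = q at h_sqrtH ⊢
  rw [← h_sqrtG, ← h_sqrtH]
  ring

lemma invariants_eq (i : Fin 6) (x : Jet) :
    invariants i x = reducedInvariants (orbitMetric (coeff x)) (hMat (coeff x))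
      (fun s => hMat (x.2.2 s)) (ehresmann x) i := by
  match i with
  | 0 => exact (traceInv_eq rho x).trans (by rw [rho_eq, sigma_eq]; rfl)
  | 1 => exact (traceInv_eq chi x).trans (by rw [chi_eq]; rfl)
  | 2 => exact congrArg (det · / _) (chi_eq x)
  | 3 => exact congrArg (det · / _) (gam_eq x)
  | 4 => exact ellC_eq x
  | 5 => exact thetaI_sq_eq x

/-! ### Smoothness -/

section Smoothness

variable {E : Type*} [NormedAddCommGroup E] [NormedSpace ℝ E] {n : WithTop ℕ∞} {x : E}

lemma contDiffAt_detPolar {m m' : E → Mat2} (hm : ContDiffAt ℝ n m x)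
    (hm' : ContDiffAt ℝ n m' x) : ContDiffAt ℝ n (fun y => detPolar (m y) (m' y)) x := by
  have h_entry {m : E → Mat2} (hm : ContDiffAt ℝ n m x) (i j : Fin 2) :
      ContDiffAt ℝ n (fun y => m y i j) x :=
    (contDiff_matrix_apply i j).contDiffAt.comp x hm
  simp only [detPolar_eq]
  exact ((((h_entry hm 0 0).mul (h_entry hm' 1 1)).add ((h_entry hm 1 1).mul (h_entry hm' 0 0))).sub
    ((h_entry hm 0 1).mul (h_entry hm' 1 0))).sub ((h_entry hm 1 0).mul (h_entry hm' 0 1))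

lemma contDiffAt_matrix_of {m : E → Fin 2 → Fin 2 → ℝ}
    (hm : ∀ i j, ContDiffAt ℝ n (fun y => m y i j) x) :
    ContDiffAt ℝ n (fun y => (of (m y) : Mat2)) x :=
  (ofLinearEquiv ℝ : (Fin 2 → Fin 2 → ℝ) ≃ₗ[ℝ] Mat2).toLinearMap.toContinuousLinearMap.contDiff
    |>.contDiffAt.comp x (contDiffAt_pi.mpr fun i => contDiffAt_pi.mpr fun j => hm i j)

lemma contDiffAt_mulVec {m : E → Mat2} {u : E → Fin 2 → ℝ} (hm : ContDiffAt ℝ n m x)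
    (hu : ContDiffAt ℝ n u x) : ContDiffAt ℝ n (fun y => m y *ᵥ u y) x :=
  contDiffAt_pi.mpr fun i => ContDiffAt.sum (s := Finset.univ) fun j _ =>
    ContDiffAt.mul (f := fun y => m y i j) ((contDiff_matrix_apply i j).contDiffAt.comp x hm)
      (contDiffAt_pi.mp hu j)

variable {g h : E → Mat2} {k : E → Fin 2 → Mat2} {c : E → Fin 2 → ℝ}

lemma contDiffAt_logDetForm (hh : ContDiffAt ℝ n h x) (hk : ContDiffAt ℝ n k x)
    (h_det : (h x).det ≠ 0) (i : Fin 2) :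
    ContDiffAt ℝ n (fun y => logDetForm (h y) (k y) i) x :=
  (contDiffAt_detPolar hh (contDiffAt_pi.mp hk i)).div
    (contDiff_matrix_det.contDiffAt.comp x hh) h_det

lemma contDiffAt_chiForm (hh : ContDiffAt ℝ n h x) (hk : ContDiffAt ℝ n k x)
    (h_det : (h x).det ≠ 0) : ContDiffAt ℝ n (fun y => chiForm (h y) (k y)) x :=
  contDiffAt_matrix_of fun i j =>
    (contDiffAt_detPolar (contDiffAt_pi.mp hk i) (contDiffAt_pi.mp hk j)).div
      (contDiffAt_const.mul (contDiff_matrix_det.contDiffAt.comp x hh))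
      (mul_ne_zero two_ne_zero h_det)

lemma contDiffAt_logDetForm_sq (hh : ContDiffAt ℝ n h x) (hk : ContDiffAt ℝ n k x)
    (h_det : (h x).det ≠ 0) :
    ContDiffAt ℝ n (fun y => vecMulVec (logDetForm (h y) (k y)) (logDetForm (h y) (k y))) x :=
  contDiffAt_matrix_of fun i j =>
    (contDiffAt_logDetForm hh hk h_det i).mul (contDiffAt_logDetForm hh hk h_det j)

lemma contDiffAt_cosgroveForm (hh : ContDiffAt ℝ n h x) (hk : ContDiffAt ℝ n k x)
    (h_det : (h x).det ≠ 0) : ContDiffAt ℝ n (fun y => cosgroveForm (h y) (k y)) x :=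
  (contDiffAt_chiForm hh hk h_det).sub ((contDiffAt_logDetForm_sq hh hk h_det).const_smul _)

lemma contDiffAt_cross {u v : E → Fin 2 → ℝ} (hu : ContDiffAt ℝ n u x)
    (hv : ContDiffAt ℝ n v x) : ContDiffAt ℝ n (fun y => cross (u y) (v y)) x :=
  ((contDiffAt_pi.mp hu 0).mul (contDiffAt_pi.mp hv 1)).sub
    ((contDiffAt_pi.mp hu 1).mul (contDiffAt_pi.mp hv 0))

theorem contDiffAt_reducedInvariants {r : ℕ∞} (hg : ContDiffAt ℝ r g x)
    (hh : ContDiffAt ℝ r h x)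
    (hk : ContDiffAt ℝ r k x) (hc : ContDiffAt ℝ r c x) (hg_det : (g x).det ≠ 0)
    (hh_det : (h x).det ≠ 0) (i : Fin 6) :
    ContDiffAt ℝ r (fun y => reducedInvariants (g y) (h y) (k y) (c y) i) x := by
  have h_detG : ContDiffAt ℝ r (fun y => (g y).det) x := contDiff_matrix_det.contDiffAt.comp x hg
  have h_detH : ContDiffAt ℝ r (fun y => (h y).det) x := contDiff_matrix_det.contDiffAt.comp x hh
  have h_absG : ContDiffAt ℝ r (fun y => |(g y).det|) x := h_detG.abs hg_det
  have h_absH : ContDiffAt ℝ r (fun y => |(h y).det|) x := h_detH.abs hh_det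
  have h_chi := contDiffAt_chiForm hh hk hh_det
  have h_gam := contDiffAt_cosgroveForm hh hk hh_det
  have h_kc (s : Fin 2) := contDiffAt_mulVec (contDiffAt_pi.mp hk s) hc
  match i with
  | 0 => exact (contDiffAt_detPolar hg (contDiffAt_logDetForm_sq hh hk hh_det)).div h_detG hg_det
  | 1 => exact (contDiffAt_detPolar hg h_chi).div h_detG hg_det
  | 2 => exact (contDiff_matrix_det.contDiffAt.comp x h_chi).div h_detG hg_det
  | 3 => exact (contDiff_matrix_det.contDiffAt.comp x h_gam).div h_detG hg_det
  | 4 =>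
    have h_hc := contDiffAt_pi.mp (contDiffAt_mulVec hh hc)
    exact (ContDiffAt.sum fun j _ => (contDiffAt_pi.mp hc j).mul (h_hc j)).div h_absG
      (abs_ne_zero.mpr hg_det)
  | 5 =>
    exact ((contDiffAt_cross (h_kc 0) (h_kc 1)).pow 2).div (h_absH.mul (h_absG.pow 3))
      (mul_ne_zero (abs_ne_zero.mpr hh_det) (pow_ne_zero 3 (abs_ne_zero.mpr hg_det)))

end Smoothness

section JetSmoothness

variable {n : WithTop ℕ∞} {x : Jet}

lemma contDiff_coeff : ContDiff ℝ n coeff := contDiff_snd.fst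

lemma contDiff_hMat_deriv : ContDiff ℝ n fun (x : Jet) s => hMat (x.2.2 s) :=
  contDiff_pi.mpr fun s => hMatL.contDiff.comp (contDiff_pi.mp contDiff_snd.snd s)

lemma contDiffAt_dfUp (hx : (hMat (coeff x)).det ≠ 0) (s : Fin 2) :
    ContDiffAt ℝ n (dfUp s) x := by
  have h_deriv : ContDiff ℝ n fun x : Jet => x.2.2 s := contDiff_pi.mp contDiff_snd.snd s
  have h_hMat : ContDiff ℝ n fun x : Jet => hMat (coeff x) := hMatL.contDiff.comp contDiff_coeff
  exact ((fMatL.contDiff.comp h_deriv).contDiffAt.sub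
    (((contDiffAt_fUp hx).comp x contDiff_coeff.contDiffAt).mul
      (hMatL.contDiff.comp h_deriv).contDiffAt)).mul
    ((contDiffAt_matrix_inv hx).comp x h_hMat.contDiffAt)

lemma isOpen_det_hMat_ne_zero : IsOpen {x : Jet | (hMat (coeff x)).det ≠ 0} :=
  isOpen_ne_fun ((contDiff_det_hMat (n := 0)).continuous.comp continuous_snd.fst) continuous_const

lemma contDiffAt_ehresmann (hx : (hMat (coeff x)).det ≠ 0) : ContDiffAt ℝ n ehresmann x := by
  have h_ev : ehresmann =ᶠ[nhds x] fun y => dfUp 1 y 0 - dfUp 0 y 1 := by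
    filter_upwards [isOpen_det_hMat_ne_zero.mem_nhds hx] with y hy using ehresmann_eq hy
  refine ContDiffAt.congr_of_eventuallyEq (contDiffAt_pi.mpr fun k => ?_) h_ev
  exact ((contDiff_matrix_apply 0 k).contDiffAt.comp x (contDiffAt_dfUp hx 1)).sub
    ((contDiff_matrix_apply 1 k).contDiffAt.comp x (contDiffAt_dfUp hx 0))

lemma det_orbitMetric_ne_zero (hx : x ∈ J1) : (orbitMetric (coeff x)).det ≠ 0 :=
  right_ne_zero_of_mul (det_metric hx.2 ▸ hx.1)

theorem contDiffAt_invariants {r : ℕ∞} (hx : x ∈ J1) (i : Fin 6) :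
    ContDiffAt ℝ r (invariants i) x := by
  rw [funext (invariants_eq i)]
  exact contDiffAt_reducedInvariants
    ((contDiffAt_orbitMetric hx.2).comp x contDiff_coeff.contDiffAt)
    (hMatL.contDiff.comp contDiff_coeff).contDiffAt contDiff_hMat_deriv.contDiffAt
    (contDiffAt_ehresmann hx.2) (det_orbitMetric_ne_zero hx) hx.2 i

end JetSmoothness

/-! ### The prolonged action -/

/-- The derivative with respect to `tˢ` of the Jacobian matrix of an adapted transformation with
second derivatives `∂²P/∂tⁱ∂tʲ = Y s(i, j)`; the columns of `z¹, z²` vanish because the Jacobian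
matrix has the constant entries `α` there. -/
def hessianMatrix (Y : Sym2 (Fin 2) → M) (s : Fin 2) : Mat4 :=
  of fun a => Sum.elim (fun j => Y s(s, j) a) 0

/-- The jet at `p` of the pull-back of a metric with jet `x'`, along an adapted transformation with
Jacobian matrix `J` and second derivatives `Y` at `p`. -/
def pullbackJet (p : M) (J : Mat4) (Y : Sym2 (Fin 2) → M) (x' : Jet) : Jet :=
  (p, ofMat (Jᵀ * metric (coeff x') * J), fun s =>
    ofMat ((hessianMatrix Y s)ᵀ * metric (coeff x') * J +
      Jᵀ * (∑ r, J (.inl r) (.inl s) • metric (x'.2.2 r)) * J +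
      Jᵀ * metric (coeff x') * hessianMatrix Y s))

lemma transpose_congr_metric (J : Mat4) (c : Coeff) :
    (Jᵀ * metric c * J)ᵀ = Jᵀ * metric c * J := by
  simp only [transpose_mul, transpose_transpose, metric_transpose, Matrix.mul_assoc]

lemma metric_coeff_pullbackJet (p : M) (J : Mat4) (Y : Sym2 (Fin 2) → M) (x' : Jet) :
    metric (coeff (pullbackJet p J Y x')) = Jᵀ * metric (coeff x') * J :=
  metric_ofMat (transpose_congr_metric J _)

lemma metric_deriv_pullbackJet (p : M) (J : Mat4) (Y : Sym2 (Fin 2) → M) (x' : Jet) (s : Fin 2) :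
    metric ((pullbackJet p J Y x').2.2 s) =
      (hessianMatrix Y s)ᵀ * metric (coeff x') * J +
        Jᵀ * (∑ r, J (.inl r) (.inl s) • metric (x'.2.2 r)) * J +
        Jᵀ * metric (coeff x') * hessianMatrix Y s := by
  refine metric_ofMat ?_
  simp only [transpose_add, transpose_mul, transpose_transpose, transpose_sum, transpose_smul,
    metric_transpose, Matrix.mul_assoc]
  abel

/-- The Jacobian matrix of a linear map, as a continuous linear map. -/
def jacobianL : (M →L[ℝ] M) →L[ℝ] Mat4 := LinearMap.toContinuousLinearMap
  ⟨⟨fun L => of fun a c => L (Pi.single c 1) a, fun _ _ => rfl⟩, fun _ _ => rfl⟩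

section Chain

/-- `tCoord` as a continuous linear map. -/
def tCoordL : M →L[ℝ] (Fin 2 → ℝ) :=
  LinearMap.toContinuousLinearMap ⟨⟨tCoord, fun _ _ => rfl⟩, fun _ _ => rfl⟩

lemma hasDerivAt_transpose_mul_mul {n : Type*} [Fintype n]
    {J K G : ℝ → Matrix n n ℝ} {J' K' G' : Matrix n n ℝ} {t : ℝ}
    (hJ : HasDerivAt J J' t) (hG : HasDerivAt G G' t) (hK : HasDerivAt K K' t) :
    HasDerivAt (fun t => (J t)ᵀ * G t * K t)
      (J'ᵀ * G t * K t + (J t)ᵀ * G' * K t + (J t)ᵀ * G t * K') t := by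
  classical
  have h_transpose : HasDerivAt (fun t => (J t)ᵀ) J'ᵀ t :=
    (transposeLinearEquiv n n ℝ ℝ).toLinearMap.toContinuousLinearMap.hasFDerivAt
      |>.comp_hasDerivAt t hJ
  exact ((h_transpose.mul hG).mul hK).congr_deriv (by rw [Matrix.add_mul]; rfl)

variable {P : M → M} {W : Set M} {p : M} {s s' : (Fin 2 → ℝ) → Coeff}

lemma hasFDerivAt_jacobian (hP : ContDiffAt ℝ ∞ P p) :
    HasFDerivAt (jacobian P) (jacobianL ∘L fderiv ℝ (fderiv ℝ P) p) p :=
  jacobianL.hasFDerivAt.comp p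
    ((hP.fderiv_right (m := ∞) le_rfl).differentiableAt (by simp)).hasFDerivAt

lemma tCoord_fderiv (v : M) :
    tCoord (fderiv ℝ P p v) =
      ∑ r, fderiv ℝ P p v (.inl r) • (Pi.single r 1 : Fin 2 → ℝ) := by
  ext i
  simp [tCoord, Pi.single_apply]

lemma jetOf_eq_pullbackJet {Y : Sym2 (Fin 2) → M} (hP : ContDiffAt ℝ ∞ P p)
    (hs : DifferentiableAt ℝ s (tCoord p)) (hs' : DifferentiableAt ℝ s' (tCoord (P p)))
    (h_pullback : ∀ᶠ q in nhds p, metric (s (tCoord q)) =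
      (jacobian P q)ᵀ * metric (s' (tCoord (P q))) * jacobian P q)
    (hY : ∀ r, fderiv ℝ (jacobian P) p (Pi.single (.inl r) 1) = hessianMatrix Y r) :
    jetOf s p = pullbackJet p (jacobian P p) Y (jetOf s' (P p)) := by
  refine Prod.ext rfl (Prod.ext ?_ (funext fun r => ?_)) <;> apply metric_injective
  · exact h_pullback.self_of_nhds.trans
      (metric_coeff_pullbackJet p (jacobian P p) Y (jetOf s' (P p))).symm
  set e : M := Pi.single (.inl r) 1
  have h_tCoord : tCoord e = Pi.single r 1 := by
    ext i
    simp [e, tCoord, Pi.single_apply]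
  have h_jac : HasLineDerivAt ℝ (jacobian P) (hessianMatrix Y r) p e :=
    hY r ▸ (hasFDerivAt_jacobian hP).differentiableAt.hasFDerivAt.hasLineDerivAt e
  have h_source : HasLineDerivAt ℝ (fun q => metric (s (tCoord q)))
      (metric ((jetOf s p).2.2 r)) p e :=
    ((metricL.hasFDerivAt.comp p (hs.hasFDerivAt.comp p tCoordL.hasFDerivAt)).hasLineDerivAt
      e).congr_deriv (congrArg (fun v => metric (fderiv ℝ s (tCoord p) v)) h_tCoord)
  have h_target : HasLineDerivAt ℝ (fun q => metric (s' (tCoord (P q))))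
      (∑ j, jacobian P p (.inl j) (.inl r) • metric ((jetOf s' (P p)).2.2 j)) p e := by
    refine ((metricL.hasFDerivAt.comp p (hs'.hasFDerivAt.comp p
      (tCoordL.hasFDerivAt.comp p (hP.differentiableAt (by simp)).hasFDerivAt))).hasLineDerivAt
      e).congr_deriv ?_
    change metricL (fderiv ℝ s' (tCoord (P p)) (tCoord (fderiv ℝ P p e))) = _
    simp only [tCoord_fderiv, map_sum, map_smul]
    rfl
  have h_congr := hasDerivAt_transpose_mul_mul h_jac h_target h_jac
  have h_line : Filter.Tendsto (fun t : ℝ => p + t • e) (nhds 0) (nhds p) :=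
    (by fun_prop : Continuous fun t : ℝ => p + t • e).tendsto' 0 p (by simp)
  rw [metric_deriv_pullbackJet]
  simpa only [zero_smul, add_zero, coeff, jetOf] using
    h_source.unique (h_congr.congr_of_eventuallyEq (h_line.eventually h_pullback))

lemma jacobian_inl_inr {α : Mat2} (hα : ∀ j, fderiv ℝ P p (dz j) = ∑ i, α i j • dz i)
    (i j : Fin 2) : jacobian P p (.inl i) (.inr j) = 0 := by
  change fderiv ℝ P p (dz j) (.inl i) = 0
  rw [hα]
  simp [dz]

lemma jacobian_inr_inr {α : Mat2} (hα : ∀ j, fderiv ℝ P p (dz j) = ∑ i, α i j • dz i)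
    (i j : Fin 2) : jacobian P p (.inr i) (.inr j) = α i j := by
  change fderiv ℝ P p (dz j) (.inr i) = α i j
  rw [hα]
  simp [dz, Pi.single_apply]

theorem IsAdaptedTransformation.exists_jacobian_eq (hP : IsAdaptedTransformation P W)
    (hp : p ∈ W) : ∃ A B α Y, A.det ≠ 0 ∧ α.det ≠ 0 ∧ jacobian P p = fromBlocks A 0 B α ∧
      ∀ s, fderiv ℝ (jacobian P) p (Pi.single (.inl s) 1) = hessianMatrix Y s := by
  obtain ⟨α, h_det, hα⟩ := hP.preserves
  have h_smooth : ContDiffAt ℝ ∞ P p := hP.contDiffOn.contDiffAt (hP.isOpen.mem_nhds hp)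
  have h_symm : IsSymmSndFDerivAt ℝ P p :=
    h_smooth.isSymmSndFDerivAt (by simpa using WithTop.coe_le_coe.mpr (le_top (a := (2 : ℕ∞))))
  have h_fderiv (v : M) := congrArg (fun L => L v) (hasFDerivAt_jacobian h_smooth).fderiv
  have h_jac : jacobian P p =
      fromBlocks (jacobian P p).toBlocks₁₁ 0 (jacobian P p).toBlocks₂₁ α := by
    conv_lhs => rw [← fromBlocks_toBlocks (jacobian P p)]
    congr 1
    · ext i j; exact jacobian_inl_inr (hα p hp) i j
    · ext i j; exact jacobian_inr_inr (hα p hp) i j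
  have h_const (a : Fin 2 ⊕ Fin 2) (j : Fin 2) (v : M) :
      fderiv ℝ (jacobian P) p v a (.inr j) = 0 := by
    have h_entry := (entryLinearMap ℝ ℝ a (.inr j)).toContinuousLinearMap.hasFDerivAt.comp p
      (hasFDerivAt_jacobian h_smooth)
    have h_eq : (fun q => jacobian P q a (.inr j)) =ᶠ[nhds p]
        fun _ => jacobian P p a (.inr j) := by
      filter_upwards [hP.isOpen.mem_nhds hp] with q hq
      rcases a with a | a
      · rw [jacobian_inl_inr (hα q hq), jacobian_inl_inr (hα p hp)]
      · rw [jacobian_inr_inr (hα q hq), jacobian_inr_inr (hα p hp)]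
    rw [h_fderiv v]
    exact congrArg (fun L => L v)
      (h_entry.unique ((hasFDerivAt_const _ p).congr_of_eventuallyEq h_eq))
  refine ⟨_, _, α, Sym2.lift ⟨fun i j => fderiv ℝ (fderiv ℝ P) p (Pi.single (.inl i) 1)
    (Pi.single (.inl j) 1), fun i j => h_symm _ _⟩, ?_, h_det, h_jac, fun s => ?_⟩
  · have h_ne := hP.det_ne_zero p hp
    rw [h_jac, det_fromBlocks_zero₁₂] at h_ne
    exact left_ne_zero_of_mul h_ne
  · ext a (c | c)
    · exact congr_fun₂ (h_fderiv _) a (.inl c)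
    · exact h_const a c _

end Chain

section QuadraticMap

variable (p p' : M) (J : Mat4) (Y : Sym2 (Fin 2) → M)

/-- The quadratic transformation with prescribed value, Jacobian matrix and second derivatives
at `p`. -/
def quadraticMap (q : M) : M :=
  p' + J *ᵥ (q - p) + (2⁻¹ : ℝ) • ∑ i, ∑ j,
    ((q (.inl i) - p (.inl i)) * (q (.inl j) - p (.inl j))) • Y s(i, j)

lemma quadraticMap_self : quadraticMap p p' J Y p = p' := by
  simp [quadraticMap]

lemma contDiff_quadraticMap : ContDiff ℝ ∞ (quadraticMap p p' J Y) := by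
  have h_mulVec : ContDiff ℝ ∞ (J *ᵥ ·) := J.mulVecLin.toContinuousLinearMap.contDiff
  unfold quadraticMap
  fun_prop

lemma jacobian_quadraticMap (q : M) : jacobian (quadraticMap p p' J Y) q =
    J + ∑ i, (q (.inl i) - p (.inl i)) • hessianMatrix Y i := by
  have h_coord (i : Fin 2) : HasFDerivAt (fun q : M => q (.inl i) - p (.inl i))
      (ContinuousLinearMap.proj (R := ℝ) (φ := fun _ => ℝ) (.inl i)) q :=
    (ContinuousLinearMap.proj (R := ℝ) (φ := fun _ => ℝ) _).hasFDerivAt.sub_const _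
  have h_linear : HasFDerivAt (fun q : M => J *ᵥ (q - p)) J.mulVecLin.toContinuousLinearMap q :=
    J.mulVecLin.toContinuousLinearMap.hasFDerivAt.comp q ((hasFDerivAt_id q).sub_const p)
  have h_quadratic : HasFDerivAt (fun q : M => ∑ i, ∑ j,
      ((q (.inl i) - p (.inl i)) * (q (.inl j) - p (.inl j))) • Y s(i, j)) _ q :=
    HasFDerivAt.fun_sum fun i _ => HasFDerivAt.fun_sum fun j _ =>
      ((h_coord i).mul (h_coord j)).smul_const (Y s(i, j))
  have h_fderiv : HasFDerivAt (quadraticMap p p' J Y) _ q :=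
    (h_linear.const_add p').add (h_quadratic.const_smul (2⁻¹ : ℝ))
  have h_swap : Y s(1, 0) = Y s(0, 1) := congrArg Y Sym2.eq_swap
  rw [jacobian, h_fderiv.fderiv]
  ext a (c | c)
  · fin_cases c <;> simp [hessianMatrix, Fin.sum_univ_two, h_swap] <;> ring
  · simp [hessianMatrix]

lemma fderiv_jacobian_quadraticMap (s : Fin 2) :
    fderiv ℝ (jacobian (quadraticMap p p' J Y)) p (Pi.single (.inl s) 1) = hessianMatrix Y s := by
  have h_fderiv : HasFDerivAt (fun q : M => J + ∑ i, (q (.inl i) - p (.inl i)) • hessianMatrix Y i)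
      _ p := (HasFDerivAt.fun_sum fun i _ => ((ContinuousLinearMap.proj (R := ℝ) (φ := fun _ => ℝ)
        (Sum.inl i)).hasFDerivAt.sub_const _).smul_const (hessianMatrix Y i)).const_add J
  rw [funext (jacobian_quadraticMap p p' J Y), h_fderiv.fderiv, Fin.sum_univ_two]
  change (Pi.single (.inl s) 1 : M) (.inl 0) • hessianMatrix Y 0 +
    (Pi.single (.inl s) 1 : M) (.inl 1) • hessianMatrix Y 1 = _
  fin_cases s <;> simp

end QuadraticMap

lemma exists_isAdaptedTransformation {P : M → M} {p : M} (hP : ContDiff ℝ ∞ P)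
    (h_det : (jacobian P p).det ≠ 0) {α : Mat2} (hα : α.det ≠ 0)
    (h : ∀ q j, fderiv ℝ P q (dz j) = ∑ i, α i j • dz i) :
    ∃ W, p ∈ W ∧ IsAdaptedTransformation P W := by
  have h_jac (q : M) : jacobian P q = LinearMap.toMatrix' (fderiv ℝ P q : M →ₗ[ℝ] M) := by
    ext a c
    simp [jacobian, LinearMap.toMatrix'_apply]
  have h_ne : (fderiv ℝ P p).det ≠ 0 := by
    rwa [h_jac, LinearMap.det_toMatrix'] at h_det
  have h_fderiv : HasFDerivAt P
      ((fderiv ℝ P p).toContinuousLinearEquivOfDetNeZero h_ne : M →L[ℝ] M) p := by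
    rw [ContinuousLinearMap.coe_toContinuousLinearEquivOfDetNeZero]
    exact (hP.differentiable (by simp) p).hasFDerivAt
  let e := hP.contDiffAt.toOpenPartialHomeomorph P h_fderiv (by simp)
  have h_cont : Continuous fun q => (jacobian P q).det :=
    (jacobianL.continuous.comp (hP.continuous_fderiv (by simp))).matrix_det
  refine ⟨e.source ∩ {q | (jacobian P q).det ≠ 0},
    ⟨hP.contDiffAt.mem_toOpenPartialHomeomorph_source h_fderiv (by simp), h_det⟩,
    e.open_source.inter (isOpen_ne_fun h_cont continuous_const), hP.contDiffOn, ?_,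
    fun q hq => hq.2, α, hα, fun q _ j => h q j⟩
  exact e.injOn.mono Set.inter_subset_left

/-- The affine section with jet `x'`. -/
def affineSection (x' : Jet) (t : Fin 2 → ℝ) : Coeff :=
  coeff x' + ∑ r, (t r - tCoord x'.1 r) • x'.2.2 r

lemma contDiff_affineSection (x' : Jet) : ContDiff ℝ ∞ (affineSection x') := by
  unfold affineSection
  fun_prop

lemma jetOf_affineSection (x' : Jet) : jetOf (affineSection x') x'.1 = x' := by
  have h_fderiv : HasFDerivAt (affineSection x') _ (tCoord x'.1) :=
    (HasFDerivAt.fun_sum fun r _ => ((ContinuousLinearMap.proj (R := ℝ) (φ := fun _ : Fin 2 => ℝ)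
      r).hasFDerivAt.sub_const _).smul_const (x'.2.2 r)).const_add (coeff x')
  refine Prod.ext rfl (Prod.ext ?_ (funext fun i => ?_))
  · simp [jetOf, affineSection, coeff]
  · fin_cases i <;> simp [jetOf, h_fderiv.fderiv]

lemma exists_transforms_of_tCoord {P : M → M} {s' : (Fin 2 → ℝ) → Coeff} (W : Set M)
    (hP : ContDiff ℝ ∞ P) (hs' : ContDiff ℝ ∞ s')
    (h_jac : ∀ q q', tCoord q = tCoord q' → jacobian P q = jacobian P q')
    (h_tCoord : ∀ q q', tCoord q = tCoord q' → tCoord (P q) = tCoord (P q')) :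
    ∃ s, Transforms P W s s' := by
  let zeroSection (t : Fin 2 → ℝ) : M := Sum.elim t 0
  have h_zero (q : M) : tCoord (zeroSection (tCoord q)) = tCoord q := rfl
  let s (t : Fin 2 → ℝ) : Coeff := ofMat ((jacobian P (zeroSection t))ᵀ *
    metric (s' (tCoord (P (zeroSection t)))) * jacobian P (zeroSection t))
  have h_section : ContDiff ℝ ∞ zeroSection := contDiff_pi.mpr fun a => by
    rcases a with a | a <;> simp only [zeroSection, Sum.elim_inl, Sum.elim_inr] <;> fun_prop
  have h_jac_smooth : ContDiff ℝ ∞ fun t => jacobian P (zeroSection t) :=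
    jacobianL.contDiff.comp ((hP.fderiv_right (m := ∞) le_rfl).comp h_section)
  have h_metric_smooth : ContDiff ℝ ∞ fun t => metric (s' (tCoord (P (zeroSection t)))) :=
    metricL.contDiff.comp (hs'.comp (tCoordL.contDiff.comp (hP.comp h_section)))
  have hs : ContDiff ℝ ∞ s := ofMatL.contDiff.comp
    (((contDiff_matrix_transpose.comp h_jac_smooth).mul h_metric_smooth).mul h_jac_smooth)
  refine ⟨s, fun _ _ => hs.contDiffAt, fun _ _ => hs'.contDiffAt, fun q _ => ?_⟩
  simp only [s, metric_ofMat (transpose_congr_metric _ _), h_tCoord _ _ (h_zero q),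
    h_jac _ _ (h_zero q)]

theorem exists_transforms_pullbackJet (p : M) {A α : Mat2} (B : Mat2) (Y : Sym2 (Fin 2) → M)
    (x' : Jet) (hA : A.det ≠ 0) (hα : α.det ≠ 0) :
    ∃ P W s s', IsAdaptedTransformation P W ∧ Transforms P W s s' ∧ p ∈ W ∧
      jetOf s p = pullbackJet p (fromBlocks A 0 B α) Y x' ∧ jetOf s' (P p) = x' := by
  set J : Mat4 := fromBlocks A 0 B α with hJ
  set P := quadraticMap p x'.1 J Y with hP
  have h_smooth : ContDiff ℝ ∞ P := contDiff_quadraticMap ..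
  have h_jac (q : M) : jacobian P q = J + ∑ i, (tCoord q i - tCoord p i) • hessianMatrix Y i :=
    jacobian_quadraticMap ..
  have h_jac_self : jacobian P p = J := by simp [h_jac]
  have h_det : (jacobian P p).det ≠ 0 := by
    rw [h_jac_self, hJ, det_fromBlocks_zero₁₂]
    exact mul_ne_zero hA hα
  have h_dz (q : M) (j : Fin 2) : fderiv ℝ P q (dz j) = ∑ i, α i j • dz i := by
    ext a
    change jacobian P q a (.inr j) = _
    rcases a with a | a <;> simp [h_jac, hJ, hessianMatrix, dz, Pi.single_apply]
  obtain ⟨W, hp, h_adapted⟩ := exists_isAdaptedTransformation h_smooth h_det hα h_dz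
  have h_section := contDiff_affineSection x'
  obtain ⟨s, h_transforms⟩ := exists_transforms_of_tCoord W h_smooth h_section
    (fun q q' h => by rw [h_jac, h_jac, h]) (fun q q' h => by
      have h_inl (i : Fin 2) : q (.inl i) = q' (.inl i) := congrFun h i
      ext i
      simp [hP, hJ, quadraticMap, tCoord, mulVec, dotProduct, h_inl])
  have h_jet : jetOf (affineSection x') (P p) = x' := by
    rw [hP, quadraticMap_self, jetOf_affineSection]
  refine ⟨P, W, s, affineSection x', h_adapted, h_transforms, hp, ?_, h_jet⟩
  have h_pullback := jetOf_eq_pullbackJet h_smooth.contDiffAt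
    ((h_transforms.smooth p hp).differentiableAt (by simp))
    ((h_transforms.smooth' p hp).differentiableAt (by simp))
    (Filter.eventually_of_mem (h_adapted.isOpen.mem_nhds hp) h_transforms.pullback)
    (fderiv_jacobian_quadraticMap p x'.1 J Y)
  rwa [h_jac_self, h_jet] at h_pullback

theorem isInvariant_iff {U : Set Jet} {F : Jet → ℝ} : IsInvariant U F ↔
    ContDiffOn ℝ ∞ F U ∧ ∀ (p : M) (A B α : Mat2) (Y : Sym2 (Fin 2) → M) (x' : Jet),
      A.det ≠ 0 → α.det ≠ 0 → pullbackJet p (fromBlocks A 0 B α) Y x' ∈ U → x' ∈ U →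
        F x' = F (pullbackJet p (fromBlocks A 0 B α) Y x') := by
  refine ⟨fun hF => ⟨hF.smooth, fun p A B α Y x' hA hα hx hx' => ?_⟩,
    fun hF => ⟨hF.1, fun P W s s' hP hT p hp hx hx' => ?_⟩⟩
  · obtain ⟨P, W, s, s', hP, hT, hp, h_jet, h_jet'⟩ :=
      exists_transforms_pullbackJet p B Y x' hA hα
    have h_inv := hF.invariant P W s s' hP hT p hp
    rw [h_jet, h_jet'] at h_inv
    exact h_inv hx hx'
  · obtain ⟨A, B, α, Y, hA, hα, h_jac, hY⟩ := hP.exists_jacobian_eq hp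
    have h_pullback := jetOf_eq_pullbackJet (hP.contDiffOn.contDiffAt (hP.isOpen.mem_nhds hp))
      ((hT.smooth p hp).differentiableAt (by simp)) ((hT.smooth' p hp).differentiableAt (by simp))
      (Filter.eventually_of_mem (hP.isOpen.mem_nhds hp) hT.pullback) hY
    rw [h_jac] at h_pullback
    rw [h_pullback] at hx ⊢
    exact hF.2 p A B α Y _ hA hα hx hx'

/-! ### Invariance -/

section Invariance

variable {p : M} {A B α : Mat2} {Y : Sym2 (Fin 2) → M} {x' : Jet}

/-- The block `∂²t̄ⁱ/∂tˢ∂tʲ` of the second derivatives `Y`. -/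
def hessianT (Y : Sym2 (Fin 2) → M) (s : Fin 2) : Mat2 := of fun i j => Y s(s, j) (.inl i)

/-- The block `∂²z̄ᵏ/∂tˢ∂tʲ` of the second derivatives `Y`. -/
def hessianZ (Y : Sym2 (Fin 2) → M) (s : Fin 2) : Mat2 := of fun k j => Y s(s, j) (.inr k)

lemma hessianMatrix_eq (s : Fin 2) :
    hessianMatrix Y s = fromBlocks (hessianT Y s) 0 (hessianZ Y s) 0 := by
  ext (a | a) (c | c) <;> rfl

lemma metric_eq_congr {c c' : Coeff}
    (hc : metric c = (fromBlocks A 0 B α)ᵀ * metric c' * fromBlocks A 0 B α) :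
    bMat c = Aᵀ * bMat c' * A + Bᵀ * (fMat c')ᵀ * A + Aᵀ * fMat c' * B + Bᵀ * hMat c' * B ∧
      fMat c = Aᵀ * fMat c' * α + Bᵀ * hMat c' * α ∧ hMat c = αᵀ * hMat c' * α := by
  simp only [metric, fromBlocks_transpose, fromBlocks_multiply, transpose_zero, Matrix.zero_mul,
    Matrix.mul_zero, zero_add] at hc
  obtain ⟨hb, hf, -, hh⟩ := fromBlocks_inj.mp hc
  refine ⟨hb.trans ?_, hf.trans (Matrix.add_mul _ _ _), hh⟩
  simp only [Matrix.add_mul]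
  abel

lemma fUp_congr {c c' : Coeff} (hα : α.det ≠ 0) (hc : (hMat c).det ≠ 0)
    (hc' : (hMat c').det ≠ 0)
    (h : metric c = (fromBlocks A 0 B α)ᵀ * metric c' * fromBlocks A 0 B α) :
    fUp c * αᵀ = Aᵀ * fUp c' + Bᵀ := by
  obtain ⟨-, hf, hh⟩ := metric_eq_congr h
  have h_unit : IsUnit (hMat c' * α) := by
    rw [isUnit_iff_isUnit_det, det_mul]
    exact (mul_ne_zero hc' hα).isUnit
  rw [← h_unit.mul_left_inj]
  calc fUp c * αᵀ * (hMat c' * α) = fUp c * (αᵀ * hMat c' * α) := by simp only [Matrix.mul_assoc]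
    _ = Aᵀ * (fUp c' * hMat c') * α + Bᵀ * hMat c' * α := by
      rw [← hh, fUp_mul_hMat hc, hf, fUp_mul_hMat hc']
    _ = (Aᵀ * fUp c' + Bᵀ) * (hMat c' * α) := by
      simp only [Matrix.add_mul, Matrix.mul_assoc]

lemma orbitMetric_congr {c c' : Coeff} (hα : α.det ≠ 0) (hc : (hMat c).det ≠ 0)
    (hc' : (hMat c').det ≠ 0)
    (h : metric c = (fromBlocks A 0 B α)ᵀ * metric c' * fromBlocks A 0 B α) :
    orbitMetric c = Aᵀ * orbitMetric c' * A := by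
  obtain ⟨hb, -, hh⟩ := metric_eq_congr h
  have h_fUp := fUp_congr hα hc hc' h
  have h_fUp' : α * (fUp c)ᵀ = (fUp c')ᵀ * A + B := by
    simpa only [transpose_mul, transpose_add, transpose_transpose] using congrArg transpose h_fUp
  have h_vertical : fUp c * hMat c * (fUp c)ᵀ =
      (Aᵀ * fUp c' + Bᵀ) * hMat c' * ((fUp c')ᵀ * A + B) := by
    rw [hh, ← h_fUp, ← h_fUp']
    simp only [Matrix.mul_assoc]
  have h_trans : (fMat c')ᵀ = hMat c' * (fUp c')ᵀ := by
    rw [← fUp_mul_hMat hc', transpose_mul, hMat_transpose]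
  rw [orbitMetric_eq_fUp hc, orbitMetric_eq_fUp hc', h_vertical, hb, h_trans, ← fUp_mul_hMat hc']
  simp only [Matrix.add_mul, Matrix.mul_add, Matrix.mul_sub, Matrix.sub_mul, Matrix.mul_assoc]
  abel

lemma deriv_pullbackJet (s : Fin 2) :
    fMat ((pullbackJet p (fromBlocks A 0 B α) Y x').2.2 s) =
        (hessianT Y s)ᵀ * fMat (coeff x') * α + (hessianZ Y s)ᵀ * hMat (coeff x') * α +
          Aᵀ * (∑ r, A r s • fMat (x'.2.2 r)) * α + Bᵀ * (∑ r, A r s • hMat (x'.2.2 r)) * α ∧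
      hMat ((pullbackJet p (fromBlocks A 0 B α) Y x').2.2 s) =
        αᵀ * (∑ r, A r s • hMat (x'.2.2 r)) * α := by
  have h_deriv := metric_deriv_pullbackJet p (fromBlocks A 0 B α) Y x' s
  simp only [hessianMatrix_eq, metric, fromBlocks_transpose, fromBlocks_multiply,
    fromBlocks_apply₁₁, transpose_zero, Matrix.zero_mul, Matrix.mul_zero, zero_add, add_zero,
    Fin.sum_univ_two, fromBlocks_smul, fromBlocks_add] at h_deriv
  obtain ⟨-, hf, -, hh⟩ := fromBlocks_inj.mp h_deriv
  simp only [Fin.sum_univ_two]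
  refine ⟨hf.trans ?_, hh⟩
  simp only [Matrix.add_mul]
  abel

lemma dfUp_pullbackJet (hα : α.det ≠ 0) (hx' : (hMat (coeff x')).det ≠ 0)
    (hx : (hMat (coeff (pullbackJet p (fromBlocks A 0 B α) Y x'))).det ≠ 0) (s : Fin 2) :
    dfUp s (pullbackJet p (fromBlocks A 0 B α) Y x') * αᵀ =
      (hessianT Y s)ᵀ * fUp (coeff x') + (hessianZ Y s)ᵀ + Aᵀ * ∑ r, A r s • dfUp r x' := by
  set x := pullbackJet p (fromBlocks A 0 B α) Y x'
  obtain ⟨hf, hh⟩ := deriv_pullbackJet (p := p) (A := A) (B := B) (α := α) (Y := Y) (x' := x') s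
  have h_metric := metric_coeff_pullbackJet p (fromBlocks A 0 B α) Y x'
  have h_unit : IsUnit (hMat (coeff x') * α) := by
    rw [isUnit_iff_isUnit_det, det_mul]
    exact (mul_ne_zero hx' hα).isUnit
  rw [← h_unit.mul_left_inj]
  calc dfUp s x * αᵀ * (hMat (coeff x') * α)
      = dfUp s x * (αᵀ * hMat (coeff x') * α) := by simp only [Matrix.mul_assoc]
    _ = fMat (x.2.2 s) - fUp (coeff x) * αᵀ * (∑ r, A r s • hMat (x'.2.2 r)) * α := by
      rw [← (metric_eq_congr h_metric).2.2, eq_sub_of_add_eq (dfUp_mul_hMat hx s), hh]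
      simp only [Matrix.mul_assoc]
    _ = ((hessianT Y s)ᵀ * fUp (coeff x') + (hessianZ Y s)ᵀ + Aᵀ * ∑ r, A r s • dfUp r x') *
          (hMat (coeff x') * α) := by
      rw [hf, fUp_congr hα hx hx' h_metric, ← fUp_mul_hMat hx']
      simp only [← dfUp_mul_hMat hx', Fin.sum_univ_two, smul_add, Matrix.add_mul, Matrix.mul_add,
        Matrix.mul_assoc, Matrix.smul_mul, Matrix.mul_smul]
      abel

lemma ehresmann_pullbackJet (hα : α.det ≠ 0) (hx' : (hMat (coeff x')).det ≠ 0)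
    (hx : (hMat (coeff (pullbackJet p (fromBlocks A 0 B α) Y x'))).det ≠ 0) :
    α *ᵥ ehresmann (pullbackJet p (fromBlocks A 0 B α) Y x') = A.det • ehresmann x' := by
  ext k
  have h0 := congrFun (congrFun (dfUp_pullbackJet hα hx' hx 0) 1) k
  have h1 := congrFun (congrFun (dfUp_pullbackJet hα hx' hx 1) 0) k
  have h_symm : s((0 : Fin 2), 1) = s(1, 0) := Sym2.eq_swap
  simp only [Matrix.mul_apply, Matrix.add_apply, transpose_apply, Matrix.smul_apply, smul_eq_mul,
    Fin.sum_univ_two, hessianT, hessianZ, of_apply, h_symm] at h0 h1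
  simp only [mulVec, dotProduct, Pi.smul_apply, smul_eq_mul, ehresmann_eq hx, ehresmann_eq hx',
    Pi.sub_apply, Fin.sum_univ_two, det_fin_two]
  linear_combination h1 - h0

end Invariance

theorem isInvariant_invariants (i : Fin 6) : IsInvariant J1 (invariants i) := by
  refine isInvariant_iff.mpr ⟨fun x hx => (contDiffAt_invariants hx i).contDiffWithinAt, ?_⟩
  intro p A B α Y x' hA hα hx hx'
  have h_metric := metric_coeff_pullbackJet p (fromBlocks A 0 B α) Y x'
  have h_deriv (s : Fin 2) :=
    (deriv_pullbackJet (p := p) (A := A) (B := B) (α := α) (Y := Y) (x' := x') s).2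
  rw [invariants_eq, invariants_eq, orbitMetric_congr hα hx.2 hx'.2 h_metric,
    (metric_eq_congr h_metric).2.2]
  simp only [h_deriv]
  rw [reducedInvariants_congr _ _ _ hA hα (ehresmann_pullbackJet hα hx'.2 hx.2)]

/-! ### Orbits of the pseudogroup -/

section LinearAlgebra

variable {ι : Type*} [Fintype ι] [DecidableEq ι]

lemma trace_eq_zero_of_transpose_mul_add_mul {g a : Matrix ι ι ℝ} (hg : g.det ≠ 0)
    (h : aᵀ * g + g * a = 0) : a.trace = 0 := by
  have h_conj : aᵀ = -(g * a * g⁻¹) := by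
    rw [← Matrix.neg_mul, ← eq_neg_of_add_eq_zero_left h,
      mul_nonsing_inv_cancel_right _ _ hg.isUnit]
  have h_trace := congrArg trace h_conj
  rw [trace_transpose, trace_neg, trace_mul_comm,
    nonsing_inv_mul_cancel_left _ _ hg.isUnit] at h_trace
  linarith

lemma eq_zero_of_transpose_eq_neg_of_mulVec_eq_zero {m : Mat2} {c : Fin 2 → ℝ} (hm : mᵀ = -m)
    (hc : c ≠ 0) (h : m *ᵥ c = 0) : m = 0 := by
  have h_entry (i j : Fin 2) : m j i = -m i j := congr_fun₂ hm i j
  have h00 : m 0 0 = 0 := by linarith [h_entry 0 0]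
  have h11 : m 1 1 = 0 := by linarith [h_entry 1 1]
  have h0 := congrFun h 0
  have h1 := congrFun h 1
  simp only [mulVec, dotProduct, Fin.sum_univ_two, h00, h11, h_entry 0 1, Pi.zero_apply, zero_mul,
    zero_add, add_zero, neg_mul, neg_eq_zero] at h0 h1
  have h01 : m 0 1 = 0 := by
    by_contra h01
    exact hc (funext fun i => match i with
      | 0 => (mul_eq_zero.mp h1).resolve_left h01
      | 1 => (mul_eq_zero.mp h0).resolve_left h01)
  ext i j
  fin_cases i <;> fin_cases j <;> simp [h00, h11, h01, h_entry 0 1]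

lemma eq_zero_of_smul_add_smul_eq_zero {u v : Fin 2 → ℝ} (huv : cross u v ≠ 0) {r s : ℝ}
    (h : r • u + s • v = 0) : r = 0 ∧ s = 0 := by
  have h_left : cross (r • u + s • v) v = 0 := by rw [h]; simp [cross]
  have h_right : cross u (r • u + s • v) = 0 := by rw [h]; simp [cross]
  rw [cross_add_left, cross_smul_left, cross_smul_left, cross_self, mul_zero, add_zero] at h_left
  rw [cross_add_right, cross_smul_right, cross_smul_right, cross_self, mul_zero, zero_add]
    at h_right
  exact ⟨(mul_eq_zero.mp h_left).resolve_right huv, (mul_eq_zero.mp h_right).resolve_right huv⟩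

lemma eq_zero_of_symm_of_skew {κ : Type*} {t : κ → κ → κ → ℝ} (h_symm : ∀ i j k, t i j k = t j i k)
    (h_skew : ∀ i j k, t i j k = -t i k j) (i j k : κ) : t i j k = 0 := by
  linarith [h_symm i j k, h_skew j i k, h_symm j k i, h_skew k j i, h_symm k i j, h_skew i k j]

end LinearAlgebra

/-- The coordinates `(p, A, B, α, Y)` of the `2`-jets of adapted transformations: a source point,
the blocks of the Jacobian matrix, and the second derivatives. -/
abbrev TransformationJet : Type := M × Mat2 × Mat2 × Mat2 × (Sym2 (Fin 2) → M)

/-- The Jacobian matrix of a transformation jet, as a continuous linear map. -/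
def jacL : TransformationJet →L[ℝ] Mat4 := LinearMap.toContinuousLinearMap
  { toFun := fun q => fromBlocks q.2.1 0 q.2.2.1 q.2.2.2.1
    map_add' := fun q q' => by simp [fromBlocks_add]
    map_smul' := fun r q => by simp [fromBlocks_smul] }

/-- The derivative of the Jacobian matrix of a transformation jet with respect to `tˢ`, as a
continuous linear map. -/
def hessianL (s : Fin 2) : TransformationJet →L[ℝ] Mat4 := LinearMap.toContinuousLinearMap
  { toFun := fun q => hessianMatrix q.2.2.2.2 s
    map_add' := fun q q' => by ext a (c | c) <;> simp [hessianMatrix]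
    map_smul' := fun r q => by ext a (c | c) <;> simp [hessianMatrix] }

/-- The `2`-jet of the identity at `p`. -/
def identityJet (p : M) : TransformationJet := (p, 1, 0, 1, 0)

lemma jacL_identityJet (p : M) : jacL (identityJet p) = 1 := fromBlocks_one

lemma hessianL_identityJet (p : M) (s : Fin 2) : hessianL s (identityJet p) = 0 := by
  ext a (c | c) <;> rfl

/-- The orbit map of the action of transformation jets on metric jets, at the jet `x`. -/
def orbitMap (x : Jet) (q : TransformationJet) : Jet := pullbackJet q.1 (jacL q) q.2.2.2.2 x

lemma sum_one_smul {E : Type*} [AddCommMonoid E] [Module ℝ E] (m : Fin 2 → E) (s : Fin 2) :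
    ∑ r, (1 : Mat4) (.inl r) (.inl s) • m r = m s := by
  simp [one_apply]

lemma orbitMap_identityJet (x : Jet) : orbitMap x (identityJet x.1) = x := by
  refine Prod.ext rfl (Prod.ext (metric_injective ?_) (funext fun s => metric_injective ?_))
  · rw [orbitMap, jacL_identityJet]
    refine (metric_coeff_pullbackJet _ _ _ _).trans ?_
    rw [transpose_one, Matrix.one_mul, Matrix.mul_one]
    rfl
  · rw [orbitMap, jacL_identityJet, metric_deriv_pullbackJet,
      sum_one_smul fun r => metric (x.2.2 r)]
    change (hessianL s (identityJet x.1))ᵀ * _ * _ + _ + _ * hessianL s (identityJet x.1) = _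
    simp only [hessianL_identityJet, transpose_zero, transpose_one, Matrix.zero_mul,
      Matrix.mul_zero, Matrix.one_mul, Matrix.mul_one, zero_add, add_zero]

lemma contDiff_orbitMap (x : Jet) : ContDiff ℝ ∞ (orbitMap x) := by
  have h_jac : ContDiff ℝ ∞ fun q => jacL q := jacL.contDiff
  have h_hessian (s : Fin 2) : ContDiff ℝ ∞ fun q => hessianL s q := (hessianL s).contDiff
  have h_transpose {f : TransformationJet → Mat4} (hf : ContDiff ℝ ∞ f) :
      ContDiff ℝ ∞ fun q => (f q)ᵀ := contDiff_matrix_transpose.comp hf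
  have h_sum (s : Fin 2) : ContDiff ℝ ∞ fun q =>
      ∑ r, jacL q (.inl r) (.inl s) • metric (x.2.2 r) :=
    ContDiff.sum fun r _ => ((contDiff_matrix_apply _ _).comp h_jac).smul contDiff_const
  refine contDiff_fst.prodMk ((ofMatL.contDiff.comp
    (((h_transpose h_jac).mul contDiff_const).mul h_jac)).prodMk (contDiff_pi.mpr fun s => ?_))
  exact ofMatL.contDiff.comp (((((h_transpose (h_hessian s)).mul contDiff_const).mul h_jac).add
    (((h_transpose h_jac).mul (h_sum s)).mul h_jac)).add
    (((h_transpose h_jac).mul contDiff_const).mul (h_hessian s)))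

lemma IsInvariant.fderiv_comp_fderiv_orbitMap {U : Set Jet} {F : Jet → ℝ} (hF : IsInvariant U F)
    (hU : IsOpen U) {x : Jet} (hx : x ∈ U) :
    fderiv ℝ F x ∘L fderiv ℝ (orbitMap x) (identityJet x.1) = 0 := by
  have h_orbit := (contDiff_orbitMap x).differentiable (by simp) (identityJet x.1)
  have h_smooth : HasFDerivAt F (fderiv ℝ F x) (orbitMap x (identityJet x.1)) := by
    rw [orbitMap_identityJet]
    exact ((hF.smooth.contDiffAt (hU.mem_nhds hx)).differentiableAt (by simp)).hasFDerivAt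
  have h_blocks : Continuous fun q : TransformationJet => (q.2.1, q.2.2.2.1) := by fun_prop
  have h_nhds : ∀ᶠ q in nhds (identityJet x.1),
      q.2.1.det ≠ 0 ∧ q.2.2.2.1.det ≠ 0 ∧ orbitMap x q ∈ U := by
    refine (h_blocks.fst.matrix_det.continuousAt.eventually_ne ?_).and
      ((h_blocks.snd.matrix_det.continuousAt.eventually_ne ?_).and
        (h_orbit.continuousAt.eventually_mem ?_))
    · simp [identityJet]
    · simp [identityJet]
    · rw [orbitMap_identityJet]; exact hU.mem_nhds hx
  have h_const : F ∘ orbitMap x =ᶠ[nhds (identityJet x.1)] fun _ => F x := by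
    filter_upwards [h_nhds] with q ⟨hA, hα, hq⟩
    exact ((isInvariant_iff.mp hF).2 _ _ _ _ _ _ hA hα hq hx).symm
  exact (h_smooth.comp _ h_orbit.hasFDerivAt).unique
    ((hasFDerivAt_const _ _).congr_of_eventuallyEq h_const)

section Tangent

variable {x : Jet} {ξ : TransformationJet}

lemma hasDerivAt_orbitMap_line (hξ : fderiv ℝ (orbitMap x) (identityJet x.1) ξ = 0) :
    HasDerivAt (fun t : ℝ => orbitMap x (identityJet x.1 + t • ξ)) 0 0 :=
  (((contDiff_orbitMap x).differentiable (by simp) (identityJet x.1)).hasFDerivAt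
    |>.hasLineDerivAt ξ).congr_deriv hξ

lemma hasDerivAt_comp_orbitMap_line {E : Type*} [NormedAddCommGroup E] [NormedSpace ℝ E]
    {φ : Jet → E} (hξ : fderiv ℝ (orbitMap x) (identityJet x.1) ξ = 0)
    (hφ : DifferentiableAt ℝ φ x) :
    HasDerivAt (fun t : ℝ => φ (orbitMap x (identityJet x.1 + t • ξ))) 0 0 := by
  have h_deriv : HasFDerivAt φ (fderiv ℝ φ x)
      (orbitMap x (identityJet x.1 + (0 : ℝ) • ξ)) := by
    rw [zero_smul, add_zero, orbitMap_identityJet]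
    exact hφ.hasFDerivAt
  exact (h_deriv.comp_hasDerivAt 0 (hasDerivAt_orbitMap_line hξ)).congr_deriv (map_zero _)

lemma fst_eq_zero_of_fderiv_orbitMap (hξ : fderiv ℝ (orbitMap x) (identityJet x.1) ξ = 0) :
    ξ.1 = 0 := by
  have h_fst := hasDerivAt_comp_orbitMap_line hξ differentiableAt_fst
  have h_line : HasDerivAt (fun t : ℝ => x.1 + t • ξ.1) ξ.1 0 := by
    simpa using ((hasDerivAt_id (0 : ℝ)).smul_const ξ.1).const_add x.1
  exact h_line.unique h_fst

lemma hasDerivAt_jacL_line (p : M) (ξ : TransformationJet) :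
    HasDerivAt (fun t : ℝ => jacL (identityJet p + t • ξ)) (jacL ξ) 0 :=
  jacL.hasFDerivAt.hasLineDerivAt ξ

lemma hasDerivAt_hessianL_line (p : M) (s : Fin 2) (ξ : TransformationJet) :
    HasDerivAt (fun t : ℝ => hessianL s (identityJet p + t • ξ)) (hessianL s ξ) 0 :=
  (hessianL s).hasFDerivAt.hasLineDerivAt ξ

lemma metric_coeff_of_fderiv_orbitMap (hξ : fderiv ℝ (orbitMap x) (identityJet x.1) ξ = 0) :
    (jacL ξ)ᵀ * metric (coeff x) + metric (coeff x) * jacL ξ = 0 := by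
  have h_zero := hasDerivAt_comp_orbitMap_line hξ
    (metricL.differentiableAt.comp x (contDiff_coeff (n := 1)).differentiable_one.differentiableAt)
  have h_jac := hasDerivAt_jacL_line x.1 ξ
  have h_congr := hasDerivAt_transpose_mul_mul h_jac
    (hasDerivAt_const (0 : ℝ) (metric (coeff x))) h_jac
  have h_unique := h_congr.unique (h_zero.congr_of_eventuallyEq (.of_forall fun t =>
    (metric_coeff_pullbackJet _ _ _ x).symm))
  simpa [jacL_identityJet] using h_unique

lemma metric_deriv_of_fderiv_orbitMap (hξ : fderiv ℝ (orbitMap x) (identityJet x.1) ξ = 0)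
    (s : Fin 2) :
    (hessianL s ξ)ᵀ * metric (coeff x) + metric (coeff x) * hessianL s ξ +
      ((jacL ξ)ᵀ * metric (x.2.2 s) + metric (x.2.2 s) * jacL ξ +
        ∑ r, ξ.2.1 r s • metric (x.2.2 r)) = 0 := by
  have h_zero := hasDerivAt_comp_orbitMap_line hξ (metricL.differentiableAt.comp x
    (by fun_prop : DifferentiableAt ℝ (fun y : Jet => y.2.2 s) x))
  have h_jac := hasDerivAt_jacL_line x.1 ξ
  have h_hess := hasDerivAt_hessianL_line x.1 s ξ
  have h_metric := hasDerivAt_const (0 : ℝ) (metric (coeff x))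
  have h_entry (r : Fin 2) : HasDerivAt
      (fun t : ℝ => jacL (identityJet x.1 + t • ξ) (.inl r) (.inl s)) (ξ.2.1 r s) 0 :=
    ((entryLinearMap ℝ ℝ (.inl r : Fin 2 ⊕ Fin 2)
      (.inl s : Fin 2 ⊕ Fin 2)).toContinuousLinearMap ∘L jacL).hasFDerivAt.hasLineDerivAt ξ
  have h_sum := HasDerivAt.fun_sum (u := Finset.univ) fun r _ =>
    (h_entry r).smul_const (metric (x.2.2 r))
  have h_congr := ((hasDerivAt_transpose_mul_mul h_hess h_metric h_jac).add
    (hasDerivAt_transpose_mul_mul h_jac h_sum h_jac)).add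
    (hasDerivAt_transpose_mul_mul h_jac h_metric h_hess)
  have h_unique := h_congr.unique (h_zero.congr_of_eventuallyEq (.of_forall fun t =>
    (metric_deriv_pullbackJet _ _ _ x s).symm))
  simp only [zero_smul, add_zero, zero_add, jacL_identityJet, hessianL_identityJet, transpose_zero,
    transpose_one, Matrix.zero_mul, Matrix.mul_zero, Matrix.one_mul, Matrix.mul_one,
    sum_one_smul] at h_unique
  rw [← h_unique]
  abel

end Tangent

/-- As for Killing fields, lowering the index makes `Y` symmetric in two slots and skew in two. -/
lemma eq_zero_of_hessianMatrix {G : Mat4} (hG : G.det ≠ 0) (hG_symm : Gᵀ = G)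
    {Y : Sym2 (Fin 2) → M}
    (hY : ∀ s, (hessianMatrix Y s)ᵀ * G + G * hessianMatrix Y s = 0) : Y = 0 := by
  have h_inl (s j : Fin 2) (a : Fin 2 ⊕ Fin 2) :
      (G * hessianMatrix Y s) a (.inl j) = (G *ᵥ Y s(s, j)) a := rfl
  have h_inr (s k : Fin 2) (a : Fin 2 ⊕ Fin 2) : (G * hessianMatrix Y s) a (.inr k) = 0 := by
    simp [mul_apply, hessianMatrix]
  have h_skew (s : Fin 2) (a b : Fin 2 ⊕ Fin 2) :
      (G * hessianMatrix Y s) b a + (G * hessianMatrix Y s) a b = 0 := by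
    have h_sum := hY s
    rw [← congrArg (_ * ·) hG_symm, ← transpose_mul] at h_sum
    exact congr_fun₂ h_sum a b
  have h_t (s j i : Fin 2) : (G *ᵥ Y s(s, j)) (.inl i) = 0 :=
    eq_zero_of_symm_of_skew (t := fun s j i => (G *ᵥ Y s(s, j)) (.inl i))
      (fun s j i => by rw [Sym2.eq_swap])
      (fun s j i => eq_neg_of_add_eq_zero_left (h_skew s (.inl j) (.inl i))) s j i
  have h_z (s j k : Fin 2) : (G *ᵥ Y s(s, j)) (.inr k) = 0 := by
    have h_mixed := h_skew s (.inr k) (.inl j)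
    rwa [h_inr, zero_add, h_inl] at h_mixed
  ext q : 1
  induction q with
  | h s j => exact eq_zero_of_mulVec_eq_zero hG (funext (Sum.rec (h_t s j) (h_z s j)))

section Tangent

variable {x : Jet} {v : M} {a β κ : Mat2} {Y : Sym2 (Fin 2) → M}

lemma jacL_mk : jacL (v, a, β, κ, Y) = fromBlocks a 0 β κ := rfl

lemma eventually_orbitMap_line (hx : (hMat (coeff x)).det ≠ 0)
    (hξ : fderiv ℝ (orbitMap x) (identityJet x.1) (v, a, β, κ, Y) = 0) :
    ∀ᶠ t : ℝ in nhds 0, (1 + t • κ).det ≠ 0 ∧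
      (hMat (coeff (orbitMap x (identityJet x.1 + t • (v, a, β, κ, Y))))).det ≠ 0 := by
  have h_cont : ContinuousAt (fun t : ℝ => orbitMap x (identityJet x.1 + t • (v, a, β, κ, Y))) 0 :=
    (hasDerivAt_orbitMap_line hξ).continuousAt
  have h_det : Continuous fun t : ℝ => (1 + t • κ).det :=
    (by fun_prop : Continuous fun t : ℝ => 1 + t • κ).matrix_det
  refine (h_det.continuousAt.eventually_ne (by simp)).and
    (h_cont.eventually_mem (isOpen_det_hMat_ne_zero.mem_nhds ?_))
  rwa [zero_smul, add_zero, orbitMap_identityJet]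

lemma transpose_mul_orbitMetric_add (hx : (hMat (coeff x)).det ≠ 0)
    (hξ : fderiv ℝ (orbitMap x) (identityJet x.1) (v, a, β, κ, Y) = 0) :
    aᵀ * orbitMetric (coeff x) + orbitMetric (coeff x) * a = 0 := by
  have h_zero := hasDerivAt_comp_orbitMap_line hξ (((contDiffAt_orbitMetric (n := 1) hx).comp x
    contDiff_coeff.contDiffAt).differentiableAt one_ne_zero)
  have h_line : HasDerivAt (fun t : ℝ => 1 + t • a) a 0 :=
    (((hasDerivAt_id (0 : ℝ)).smul_const a).const_add 1).congr_deriv (one_smul _ _)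
  have h_congr := hasDerivAt_transpose_mul_mul h_line
    (hasDerivAt_const (0 : ℝ) (orbitMetric (coeff x))) h_line
  have h_unique := h_congr.unique (h_zero.congr_of_eventuallyEq ?_)
  · simpa using h_unique
  · filter_upwards [eventually_orbitMap_line hx hξ] with t ⟨hα, ht⟩
    exact (orbitMetric_congr hα ht hx (metric_coeff_pullbackJet _ _ _ x)).symm

lemma mulVec_ehresmann_eq (hx : (hMat (coeff x)).det ≠ 0)
    (hξ : fderiv ℝ (orbitMap x) (identityJet x.1) (v, a, β, κ, Y) = 0) :
    κ *ᵥ ehresmann x = a.trace • ehresmann x := by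
  have h_zero := hasDerivAt_comp_orbitMap_line hξ
    ((contDiffAt_ehresmann (n := 1) hx).differentiableAt (by simp))
  have h_entry (m : Mat2) (i j : Fin 2) :
      HasDerivAt (fun t : ℝ => (1 + t • m) i j) (m i j) 0 := by
    simpa using ((hasDerivAt_id (0 : ℝ)).mul_const (m i j)).const_add ((1 : Mat2) i j)
  ext k
  have h_left := HasDerivAt.fun_sum (u := Finset.univ) fun l _ =>
    (h_entry κ k l).mul (hasDerivAt_pi.mp h_zero l)
  have h_right := (((h_entry a 0 0).mul (h_entry a 1 1)).sub
    ((h_entry a 0 1).mul (h_entry a 1 0))).mul_const (ehresmann x k)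
  have h_unique := h_left.unique (h_right.congr_of_eventuallyEq ?_)
  · simpa [orbitMap_identityJet, mulVec, dotProduct, trace_fin_two] using h_unique
  · filter_upwards [eventually_orbitMap_line hx hξ] with t ⟨hα, ht⟩
    have h_curv := congrFun (ehresmann_pullbackJet hα hx ht) k
    rw [det_fin_two] at h_curv
    exact h_curv

lemma blocks_metric_coeff (hξ : fderiv ℝ (orbitMap x) (identityJet x.1) (v, a, β, κ, Y) = 0) :
    aᵀ * fMat (coeff x) + βᵀ * hMat (coeff x) + fMat (coeff x) * κ = 0 ∧
      κᵀ * hMat (coeff x) + hMat (coeff x) * κ = 0 := by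
  have h_coeff := metric_coeff_of_fderiv_orbitMap hξ
  simp only [jacL_mk, metric, fromBlocks_transpose, fromBlocks_multiply, fromBlocks_add,
    transpose_zero, Matrix.zero_mul, Matrix.mul_zero, zero_add] at h_coeff
  rw [← fromBlocks_zero, fromBlocks_inj] at h_coeff
  exact ⟨h_coeff.2.1, h_coeff.2.2.2⟩

lemma block_metric_deriv (hξ : fderiv ℝ (orbitMap x) (identityJet x.1) (v, a, β, κ, Y) = 0)
    (s : Fin 2) :
    κᵀ * hMat (x.2.2 s) + hMat (x.2.2 s) * κ + ∑ r, a r s • hMat (x.2.2 r) = 0 := by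
  have h_deriv := metric_deriv_of_fderiv_orbitMap hξ s
  change (hessianMatrix Y s)ᵀ * _ + _ * hessianMatrix Y s + _ = 0 at h_deriv
  simp only [jacL_mk, hessianMatrix_eq, metric, fromBlocks_transpose, fromBlocks_multiply,
    fromBlocks_add, fromBlocks_smul, Fin.sum_univ_two,
    transpose_zero, Matrix.zero_mul, Matrix.mul_zero, zero_add] at h_deriv
  rw [← fromBlocks_zero, fromBlocks_inj] at h_deriv
  rw [Fin.sum_univ_two]
  exact h_deriv.2.2.2

theorem eq_zero_of_fderiv_orbitMap (hx : x ∈ J1)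
    (hΘ : cross (hMat (x.2.2 0) *ᵥ ehresmann x) (hMat (x.2.2 1) *ᵥ ehresmann x) ≠ 0)
    {ξ : TransformationJet} (hξ : fderiv ℝ (orbitMap x) (identityJet x.1) ξ = 0) : ξ = 0 := by
  obtain ⟨v, a, β, κ, Y⟩ := ξ
  have hc : ehresmann x ≠ 0 := fun hc => hΘ (by simp [hc, cross])
  obtain ⟨h_f, h_h⟩ := blocks_metric_coeff hξ
  have h_fix : κ *ᵥ ehresmann x = 0 := by
    rw [mulVec_ehresmann_eq hx.2 hξ, trace_eq_zero_of_transpose_mul_add_mul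
      (det_orbitMetric_ne_zero hx) (transpose_mul_orbitMetric_add hx.2 hξ), zero_smul]
  have hκ : κ = 0 := by
    have h_skew : (hMat (coeff x) * κ)ᵀ = -(hMat (coeff x) * κ) := by
      rw [transpose_mul, hMat_transpose]
      exact eq_neg_of_add_eq_zero_left h_h
    have h_mul := eq_zero_of_transpose_eq_neg_of_mulVec_eq_zero h_skew hc
      (by rw [← mulVec_mulVec, h_fix, mulVec_zero])
    rw [← nonsing_inv_mul_cancel_left (hMat (coeff x)) κ hx.2.isUnit, h_mul, Matrix.mul_zero]
  have ha : a = 0 := by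
    have h_comb (s : Fin 2) : a 0 s • hMat (x.2.2 0) *ᵥ ehresmann x +
        a 1 s • hMat (x.2.2 1) *ᵥ ehresmann x = 0 := by
      have h_deriv := congrArg (· *ᵥ ehresmann x) (block_metric_deriv hξ s)
      simpa [hκ, add_mulVec, smul_mulVec] using h_deriv
    ext r s
    match r with
    | 0 => exact (eq_zero_of_smul_add_smul_eq_zero hΘ (h_comb s)).1
    | 1 => exact (eq_zero_of_smul_add_smul_eq_zero hΘ (h_comb s)).2
  have hβ : β = 0 := by
    rw [ha, hκ, transpose_zero, Matrix.zero_mul, Matrix.mul_zero, zero_add, add_zero] at h_f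
    rw [← transpose_eq_zero, ← mul_nonsing_inv_cancel_right (hMat (coeff x)) βᵀ hx.2.isUnit, h_f,
      Matrix.zero_mul]
  have hY : Y = 0 := eq_zero_of_hessianMatrix hx.1 (metric_transpose _) fun s => by
    have h_deriv := metric_deriv_of_fderiv_orbitMap hξ s
    change (hessianMatrix Y s)ᵀ * _ + _ * hessianMatrix Y s + _ = 0 at h_deriv
    simpa [ha, hκ, hβ, jacL_mk, fromBlocks_zero] using h_deriv
  rw [show v = 0 from fst_eq_zero_of_fderiv_orbitMap hξ, ha, hβ, hκ, hY]
  rfl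

end Tangent

lemma card_add_finrank_le_of_comp_eq_zero {V W ι : Type*} [AddCommGroup V] [Module ℝ V]
    [AddCommGroup W] [Module ℝ W] [FiniteDimensional ℝ W] [Fintype ι] {T : V →ₗ[ℝ] W}
    (hT : Function.Injective T) {φ : ι → Module.Dual ℝ W} (hφ : LinearIndependent ℝ φ)
    (h : ∀ i, φ i ∘ₗ T = 0) :
    Fintype.card ι + Module.finrank ℝ V ≤ Module.finrank ℝ W := by
  have h_le : Submodule.span ℝ (Set.range φ) ≤ (LinearMap.range T).dualAnnihilator := by
    rw [Submodule.span_le]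
    rintro _ ⟨i, rfl⟩
    rw [SetLike.mem_coe, Submodule.mem_dualAnnihilator]
    rintro _ ⟨v, rfl⟩
    exact LinearMap.congr_fun (h i) v
  have h_card := Submodule.finrank_mono h_le
  rw [finrank_span_eq_card hφ] at h_card
  have h_sum := Subspace.finrank_add_finrank_dualAnnihilator_eq (LinearMap.range T)
  rw [LinearMap.finrank_range_of_inj hT] at h_sum
  omega

lemma finrank_transformationJet : Module.finrank ℝ TransformationJet = 28 := by
  simp [TransformationJet, M, Module.finrank_prod, Module.finrank_matrix, Module.finrank_pi_fintype,
    Sym2.card]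

lemma finrank_jet : Module.finrank ℝ Jet = 34 := by
  simp [Jet, M, Coeff, Module.finrank_prod, Module.finrank_pi_fintype, Sym2.card]

theorem not_functionallyIndependentAt_of_cross_ne_zero {U : Set Jet} (hU : IsOpen U) (hJ : U ⊆ J1)
    {F : Fin 7 → Jet → ℝ} (hF : ∀ i, IsInvariant U (F i)) {x : Jet} (hx : x ∈ U)
    (hΘ : cross (hMat (x.2.2 0) *ᵥ ehresmann x) (hMat (x.2.2 1) *ᵥ ehresmann x) ≠ 0) :
    ¬ FunctionallyIndependentAt F x := by
  intro h_indep
  have h_dual : LinearIndependent ℝ fun i => (fderiv ℝ (F i) x : Jet →ₗ[ℝ] ℝ) :=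
    h_indep.map' (ContinuousLinearMap.coeLM ℝ)
      (LinearMap.ker_eq_bot.mpr ContinuousLinearMap.coe_injective)
  have h_card := card_add_finrank_le_of_comp_eq_zero
    (T := (fderiv ℝ (orbitMap x) (identityJet x.1) : TransformationJet →ₗ[ℝ] Jet))
    ((injective_iff_map_eq_zero _).mpr fun _ => eq_zero_of_fderiv_orbitMap (hJ hx) hΘ) h_dual
    fun i => congrArg ContinuousLinearMap.toLinearMap ((hF i).fderiv_comp_fderiv_orbitMap hU hx)
  rw [finrank_transformationJet, finrank_jet, Fintype.card_fin] at h_card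
  omega

/-! ### Differentials of the invariants along the fibres -/

section Calculus

variable {t : ℝ}

lemma hasDerivAt_detPolar (g : Mat2) {m : ℝ → Mat2} {m' : Mat2}
    (hm : ∀ i j, HasDerivAt (fun s => m s i j) (m' i j) t) :
    HasDerivAt (fun s => detPolar g (m s)) (detPolar g m') t := by
  simp only [detPolar_eq]
  exact ((((hm 1 1).const_mul _).add ((hm 0 0).const_mul _)).sub ((hm 1 0).const_mul _)).sub
    ((hm 0 1).const_mul _)

lemma hasDerivAt_det_fin_two {m : ℝ → Mat2} {m' : Mat2}
    (hm : ∀ i j, HasDerivAt (fun s => m s i j) (m' i j) t) :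
    HasDerivAt (fun s => (m s).det) (detPolar (m t) m') t := by
  simp only [det_fin_two]
  refine (((hm 0 0).mul (hm 1 1)).sub ((hm 0 1).mul (hm 1 0))).congr_deriv ?_
  rw [detPolar_eq]
  ring

lemma hasDerivAt_add_smul {ι : Type*} (u v : ι → ℝ) (i : ι) :
    HasDerivAt (fun s : ℝ => (u + s • v) i) (v i) t := by
  simpa using ((hasDerivAt_id t).mul_const (v i)).const_add (u i)

end Calculus

section Variations

variable {g h : Mat2} {k : Fin 2 → Mat2} {c : Fin 2 → ℝ}

lemma hasDerivAt_reducedInvariants_four (hh : hᵀ = h) (e : Fin 2 → ℝ) :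
    HasDerivAt (fun t : ℝ => reducedInvariants g h k (c + t • e) 4)
      (2 * (e ⬝ᵥ h *ᵥ c) / |g.det|) 0 := by
  have h_symm : c ⬝ᵥ h *ᵥ e = e ⬝ᵥ h *ᵥ c := by
    rw [dotProduct_mulVec, ← mulVec_transpose, hh, dotProduct_comm]
  have h_expand (t : ℝ) : reducedInvariants g h k (c + t • e) 4 =
      (c ⬝ᵥ h *ᵥ c + t * (2 * (e ⬝ᵥ h *ᵥ c)) + t ^ 2 * (e ⬝ᵥ h *ᵥ e)) / |g.det| := by
    change ((c + t • e) ⬝ᵥ h *ᵥ (c + t • e)) / |g.det| = _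
    simp only [mulVec_add, mulVec_smul, add_dotProduct, dotProduct_add, smul_dotProduct,
      dotProduct_smul, smul_eq_mul, h_symm]
    ring
  simp only [h_expand]
  refine (((((hasDerivAt_id (0 : ℝ)).mul_const _).const_add _).add
    (((hasDerivAt_id (0 : ℝ)).pow 2).mul_const _)).div_const _).congr_deriv ?_
  simp

lemma hasDerivAt_reducedInvariants_five (e : Fin 2 → ℝ) :
    HasDerivAt (fun t : ℝ => reducedInvariants g h k (c + t • e) 5)
      (2 * cross (k 0 *ᵥ c) (k 1 *ᵥ c) *
        (cross (k 0 *ᵥ e) (k 1 *ᵥ c) + cross (k 0 *ᵥ c) (k 1 *ᵥ e)) /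
          (|h.det| * |g.det| ^ 3)) 0 := by
  have h_entry (m : Mat2) (i : Fin 2) :
      HasDerivAt (fun t : ℝ => (m *ᵥ (c + t • e)) i) ((m *ᵥ e) i) 0 := by
    simpa only [mulVec_add, mulVec_smul] using hasDerivAt_add_smul (m *ᵥ c) (m *ᵥ e) i
  have h_cross := ((h_entry (k 0) 0).mul (h_entry (k 1) 1)).sub
    ((h_entry (k 0) 1).mul (h_entry (k 1) 0))
  refine ((h_cross.pow 2).div_const (|h.det| * |g.det| ^ 3)).congr_deriv ?_
  simp [cross]
  ring

/-- The trace-free part, with respect to `h`, of the partial derivatives `k` of `h`. -/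
def traceFree (h : Mat2) (k : Fin 2 → Mat2) (r : Fin 2) : Mat2 :=
  k r - (logDetForm h k r / 2) • h

lemma detPolar_traceFree (hh : h.det ≠ 0) (r : Fin 2) : detPolar h (traceFree h k r) = 0 := by
  rw [traceFree, sub_eq_add_neg, ← neg_smul, detPolar_add_right, detPolar_smul_right,
    detPolar_self, logDetForm]
  field_simp
  ring

lemma cosgroveForm_eq_chiForm_traceFree (hh : h.det ≠ 0) :
    cosgroveForm h k = chiForm h (traceFree h k) := by
  ext i j
  simp only [cosgroveForm, chiForm, traceFree, logDetForm, Matrix.sub_apply, Matrix.smul_apply,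
    of_apply, vecMulVec_apply, smul_eq_mul, sub_eq_add_neg, ← neg_smul, detPolar_add_left,
    detPolar_add_right, detPolar_smul_left, detPolar_smul_right, detPolar_self,
    detPolar_comm _ h]
  field_simp
  ring

/-- The variation of `k` which scales its trace-free part by `ε` and shifts its trace by `τ`. -/
def variation (h : Mat2) (k : Fin 2 → Mat2) (ε τ : Fin 2 → ℝ) (r : Fin 2) : Mat2 :=
  ε r • traceFree h k r + τ r • h

variable (ε τ : Fin 2 → ℝ)

lemma logDetForm_add_smul_variation (hh : h.det ≠ 0) (t : ℝ) :
    logDetForm h (k + t • variation h k ε τ) = logDetForm h k + t • (2 : ℝ) • τ := by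
  ext r
  simp only [logDetForm, variation, Pi.add_apply, Pi.smul_apply, detPolar_add_right,
    detPolar_smul_right, detPolar_traceFree hh, detPolar_self, smul_eq_mul]
  field_simp
  ring

lemma traceFree_add_smul_variation (hh : h.det ≠ 0) (t : ℝ) (r : Fin 2) :
    traceFree h (k + t • variation h k ε τ) r = (1 + t * ε r) • traceFree h k r := by
  rw [traceFree, logDetForm_add_smul_variation ε τ hh]
  simp only [variation, traceFree, Pi.add_apply, Pi.smul_apply, smul_eq_mul]
  module

/-- The variation of the form `ρ` along `variation h k ε τ`. -/
def deltaRho (h : Mat2) (k : Fin 2 → Mat2) (τ : Fin 2 → ℝ) : Mat2 :=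
  (2 : ℝ) • (vecMulVec τ (logDetForm h k) + vecMulVec (logDetForm h k) τ)

/-- The variation of the Cosgrove form along `variation h k ε τ`. -/
def deltaCosgrove (h : Mat2) (k : Fin 2 → Mat2) (ε : Fin 2 → ℝ) : Mat2 :=
  of fun i j => (ε i + ε j) * cosgroveForm h k i j

lemma hasDerivAt_vecMulVec_logDetForm (hh : h.det ≠ 0) (i j : Fin 2) :
    HasDerivAt (fun t : ℝ => vecMulVec (logDetForm h (k + t • variation h k ε τ))
      (logDetForm h (k + t • variation h k ε τ)) i j) (deltaRho h k τ i j) 0 := by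
  simp only [logDetForm_add_smul_variation ε τ hh, vecMulVec_apply]
  refine ((hasDerivAt_add_smul _ _ i).mul (hasDerivAt_add_smul _ _ j)).congr_deriv ?_
  simp [deltaRho, vecMulVec_apply]
  ring

lemma hasDerivAt_cosgroveForm (hh : h.det ≠ 0) (i j : Fin 2) :
    HasDerivAt (fun t : ℝ => cosgroveForm h (k + t • variation h k ε τ) i j)
      (deltaCosgrove h k ε i j) 0 := by
  have h_expand (t : ℝ) : cosgroveForm h (k + t • variation h k ε τ) i j =
      (1 + t * ε i) * (1 + t * ε j) * cosgroveForm h k i j := by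
    simp only [cosgroveForm_eq_chiForm_traceFree hh, chiForm, of_apply,
      traceFree_add_smul_variation ε τ hh, detPolar_smul_left, detPolar_smul_right]
    ring
  have h_scale (r : Fin 2) : HasDerivAt (fun t : ℝ => 1 + t * ε r) (ε r) 0 := by
    simpa using ((hasDerivAt_id (0 : ℝ)).mul_const (ε r)).const_add 1
  simp only [h_expand]
  refine (((h_scale i).mul (h_scale j)).mul_const _).congr_deriv ?_
  simp [deltaCosgrove]

lemma hasDerivAt_chiForm (hh : h.det ≠ 0) (i j : Fin 2) :
    HasDerivAt (fun t : ℝ => chiForm h (k + t • variation h k ε τ) i j)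
      ((deltaCosgrove h k ε + (1 / 4 : ℝ) • deltaRho h k τ) i j) 0 := by
  refine ((hasDerivAt_cosgroveForm ε τ hh i j).add
    ((hasDerivAt_vecMulVec_logDetForm ε τ hh i j).const_mul (1 / 4))).congr_of_eventuallyEq
      (.of_forall fun t => ?_)
  simp [cosgroveForm]

/-- The derivatives of `C_ρ, C_χ, Q_χ, Q_γ` along `variation h k ε τ`. -/
def deltaInvariants (g h : Mat2) (k : Fin 2 → Mat2) (ε τ : Fin 2 → ℝ) : Fin 4 → ℝ :=
  ![detPolar g (deltaRho h k τ) / g.det,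
    detPolar g (deltaCosgrove h k ε + (1 / 4 : ℝ) • deltaRho h k τ) / g.det,
    detPolar (chiForm h k) (deltaCosgrove h k ε + (1 / 4 : ℝ) • deltaRho h k τ) / g.det,
    detPolar (cosgroveForm h k) (deltaCosgrove h k ε) / g.det]

lemma hasDerivAt_reducedInvariants_variation (hh : h.det ≠ 0) (i : Fin 4) :
    HasDerivAt (fun t : ℝ => reducedInvariants g h (k + t • variation h k ε τ) c (i.castAdd 2))
      (deltaInvariants g h k ε τ i) 0 := by
  match i with
  | 0 => exact (hasDerivAt_detPolar g (hasDerivAt_vecMulVec_logDetForm ε τ hh)).div_const _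
  | 1 => exact (hasDerivAt_detPolar g (hasDerivAt_chiForm ε τ hh)).div_const _
  | 2 =>
    have h_det := hasDerivAt_det_fin_two (hasDerivAt_chiForm (k := k) ε τ hh)
    rw [zero_smul, add_zero] at h_det
    exact h_det.div_const _
  | 3 =>
    have h_det := hasDerivAt_det_fin_two (hasDerivAt_cosgroveForm (k := k) ε τ hh)
    rw [zero_smul, add_zero] at h_det
    exact h_det.div_const _

end Variations

/-! ### Independence at generic jets -/

section Elimination

variable {g h : Mat2} {k : Fin 2 → Mat2} {c : Fin 2 → ℝ}

/-- The polynomial condition on the orbit metric `g`, `h = 𝐡`, its partial derivatives `k`, the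
Ehresmann curvature `c`, the form `σ` and the Cosgrove form `γ` under which the invariants are
shown to be independent. In the third factor, `Θ_I` is polarized in the direction orthogonal
to `c`. -/
def genericity (g h : Mat2) (k : Fin 2 → Mat2) (c σ : Fin 2 → ℝ) (γ : Mat2) : ℝ :=
  (c ⬝ᵥ h *ᵥ c) * cross (k 0 *ᵥ c) (k 1 *ᵥ c) *
    (cross (k 0 *ᵥ ![-(h *ᵥ c) 1, (h *ᵥ c) 0]) (k 1 *ᵥ c) +
      cross (k 0 *ᵥ c) (k 1 *ᵥ ![-(h *ᵥ c) 1, (h *ᵥ c) 0])) *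
    cross (adjugate g *ᵥ σ) (adjugate γ *ᵥ σ) * (γ 0 0 * g 1 1 - γ 1 1 * g 0 0) * γ.det

lemma genericity_smul (a b r s : ℝ) (g h : Mat2) (k : Fin 2 → Mat2) (c σ : Fin 2 → ℝ)
    (γ : Mat2) : genericity (a • g) h k (b • c) (r • σ) (s • γ) =
      a ^ 2 * b ^ 6 * r ^ 2 * s ^ 4 * genericity g h k c σ γ := by
  have h_orth : ![-(h *ᵥ (b • c)) 1, (h *ᵥ (b • c)) 0] = b • ![-(h *ᵥ c) 1, (h *ᵥ c) 0] := by
    simp only [mulVec_smul, Pi.smul_apply, smul_eq_mul, smul_cons, smul_empty, mul_neg]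
  rw [genericity, h_orth]
  simp only [genericity, mulVec_smul, smul_mulVec, cross_smul_left, cross_smul_right,
    smul_dotProduct, dotProduct_smul, det_smul, Fintype.card_fin, adjugate_smul, Matrix.smul_apply,
    smul_eq_mul]
  ring

lemma detPolar_zero_right (m : Mat2) : detPolar m 0 = 0 := by
  rw [detPolar, Matrix.mul_zero, trace_zero]

lemma cosgroveForm_transpose : (cosgroveForm h k)ᵀ = cosgroveForm h k := by
  ext i j
  simp [cosgroveForm, chiForm, vecMulVec_apply, detPolar_comm (k j), mul_comm]

lemma detPolar_vecMulVec_add {m : Mat2} (hm : mᵀ = m) (u v : Fin 2 → ℝ) :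
    detPolar m (vecMulVec u v + vecMulVec v u) = 2 * (u ⬝ᵥ adjugate m *ᵥ v) := by
  have h_symm : v ⬝ᵥ adjugate m *ᵥ u = u ⬝ᵥ adjugate m *ᵥ v := by
    rw [dotProduct_mulVec, ← mulVec_transpose, adjugate_transpose, hm, dotProduct_comm]
  rw [detPolar_add_right, detPolar_vecMulVec, detPolar_vecMulVec, h_symm, two_mul]

lemma detPolar_vecMulVec_self_add (u v : Fin 2 → ℝ) :
    detPolar (vecMulVec v v) (vecMulVec u v + vecMulVec v u) = 0 := by
  simp only [detPolar_eq, Matrix.add_apply, vecMulVec_apply]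
  ring

lemma detPolar_deltaRho {m : Mat2} (hm : mᵀ = m) (τ : Fin 2 → ℝ) :
    detPolar m (deltaRho h k τ) = 4 * (τ ⬝ᵥ adjugate m *ᵥ logDetForm h k) := by
  rw [deltaRho, detPolar_smul_right, detPolar_vecMulVec_add hm]
  ring

lemma detPolar_chiForm_deltaRho (τ : Fin 2 → ℝ) :
    detPolar (chiForm h k) (deltaRho h k τ) =
      4 * (τ ⬝ᵥ adjugate (cosgroveForm h k) *ᵥ logDetForm h k) := by
  have h_chi : chiForm h k = cosgroveForm h k +
      (1 / 4 : ℝ) • vecMulVec (logDetForm h k) (logDetForm h k) := by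
    rw [cosgroveForm, sub_add_cancel]
  rw [h_chi, detPolar_add_left, detPolar_deltaRho cosgroveForm_transpose, deltaRho,
    detPolar_smul_right, detPolar_smul_left, detPolar_vecMulVec_self_add, mul_zero, mul_zero,
    add_zero]

lemma deltaRho_zero : deltaRho h k 0 = 0 := by
  simp [deltaRho]

lemma deltaCosgrove_zero : deltaCosgrove h k 0 = 0 := by
  ext i j
  simp [deltaCosgrove]

lemma deltaCosgrove_one : deltaCosgrove h k 1 = (2 : ℝ) • cosgroveForm h k := by
  ext i j
  norm_num [deltaCosgrove]

lemma detPolar_deltaCosgrove_one_neg_one (m : Mat2) :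
    detPolar m (deltaCosgrove h k ![1, -1]) =
      2 * (cosgroveForm h k 0 0 * m 1 1 - cosgroveForm h k 1 1 * m 0 0) := by
  simp [detPolar_eq, deltaCosgrove]
  ring

lemma eq_zero_of_sum_mul_deltaInvariants (hg : g.det ≠ 0) (hg_symm : gᵀ = g)
    (h_gen : genericity g h k c (logDetForm h k) (cosgroveForm h k) ≠ 0) {l : Fin 4 → ℝ}
    (hl : ∀ ε τ, ∑ i, l i * deltaInvariants g h k ε τ i = 0) : l = 0 := by
  simp only [genericity, mul_ne_zero_iff] at h_gen
  obtain ⟨⟨⟨-, h_sigma⟩, h_diag⟩, h_det⟩ := h_gen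
  have h_expand (ε τ : Fin 2 → ℝ) :
      l 0 * detPolar g (deltaRho h k τ) +
        l 1 * detPolar g (deltaCosgrove h k ε + (1 / 4 : ℝ) • deltaRho h k τ) +
        l 2 * detPolar (chiForm h k) (deltaCosgrove h k ε + (1 / 4 : ℝ) • deltaRho h k τ) +
        l 3 * detPolar (cosgroveForm h k) (deltaCosgrove h k ε) = 0 := by
    have h_sum := hl ε τ
    simp only [Fin.sum_univ_four, deltaInvariants, cons_val] at h_sum
    field_simp at h_sum
    linear_combination h_sum
  have h_trace : (4 * l 0 + l 1) • adjugate g *ᵥ logDetForm h k +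
      l 2 • adjugate (cosgroveForm h k) *ᵥ logDetForm h k = 0 := by
    refine dotProduct_eq_zero _ fun τ => ?_
    have h_tau := h_expand 0 τ
    simp only [deltaCosgrove_zero, zero_add, detPolar_smul_right, detPolar_deltaRho hg_symm,
      detPolar_chiForm_deltaRho, detPolar_zero_right, mul_zero, add_zero] at h_tau
    rw [dotProduct_comm, dotProduct_add, dotProduct_smul, dotProduct_smul, smul_eq_mul,
      smul_eq_mul]
    linear_combination h_tau
  obtain ⟨h01, h2⟩ := eq_zero_of_smul_add_smul_eq_zero h_sigma h_trace
  have h1 : l 1 = 0 := by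
    have h_eps := h_expand ![1, -1] 0
    simp only [deltaRho_zero, smul_zero, add_zero, h2, detPolar_deltaCosgrove_one_neg_one,
      detPolar_zero_right] at h_eps
    refine (mul_eq_zero.mp ?_).resolve_right h_diag
    linear_combination h_eps / 2
  have h3 : l 3 = 0 := by
    have h_eps := h_expand 1 0
    simp only [deltaRho_zero, smul_zero, add_zero, h2, h1, deltaCosgrove_one,
      detPolar_zero_right, detPolar_smul_right, detPolar_self] at h_eps
    refine (mul_eq_zero.mp ?_).resolve_right h_det
    linear_combination h_eps / 4
  have h0 : l 0 = 0 := by linarith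
  ext i
  match i with
  | 0 => exact h0
  | 1 => exact h1
  | 2 => exact h2
  | 3 => exact h3

lemma eq_zero_of_curvature_variations (hg : g.det ≠ 0) (hh : h.det ≠ 0)
    {σ : Fin 2 → ℝ} {γ : Mat2} (h_gen : genericity g h k c σ γ ≠ 0) {r s : ℝ}
    (hrs : ∀ e, r * (2 * (e ⬝ᵥ h *ᵥ c) / |g.det|) +
      s * (2 * cross (k 0 *ᵥ c) (k 1 *ᵥ c) *
        (cross (k 0 *ᵥ e) (k 1 *ᵥ c) + cross (k 0 *ᵥ c) (k 1 *ᵥ e)) /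
          (|h.det| * |g.det| ^ 3)) = 0) : r = 0 ∧ s = 0 := by
  simp only [genericity, mul_ne_zero_iff] at h_gen
  obtain ⟨⟨⟨⟨⟨h_ell, h_theta⟩, h_polar⟩, -⟩, -⟩, -⟩ := h_gen
  have hg_abs := abs_ne_zero.mpr hg
  have hh_abs := abs_ne_zero.mpr hh
  have hs : s = 0 := by
    have h_orth : ![-(h *ᵥ c) 1, (h *ᵥ c) 0] ⬝ᵥ h *ᵥ c = 0 := by
      rw [dotProduct, Fin.sum_univ_two]
      simp only [cons_val]
      ring
    have h_eq := hrs ![-(h *ᵥ c) 1, (h *ᵥ c) 0]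
    rw [h_orth, mul_zero, zero_div, mul_zero, zero_add] at h_eq
    refine (mul_eq_zero.mp h_eq).resolve_right (div_ne_zero ?_
      (mul_ne_zero hh_abs (pow_ne_zero 3 hg_abs)))
    exact mul_ne_zero (mul_ne_zero two_ne_zero h_theta) h_polar
  have h_eq := hrs c
  rw [hs, zero_mul, add_zero] at h_eq
  exact ⟨(mul_eq_zero.mp h_eq).resolve_right
    (div_ne_zero (mul_ne_zero two_ne_zero h_ell) hg_abs), hs⟩

end Elimination

section Fibre

variable {x : Jet}

/-- The direction tangent to the fibre of `J¹τ → τ` along which the derivatives of `𝐡` vary by `E`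
and the Ehresmann curvature by `e`. -/
def fibreVector (x : Jet) (E : Fin 2 → Mat2) (e : Fin 2 → ℝ) : Jet :=
  let F (s : Fin 2) := of ![(s : ℝ) • e, 0] * hMat (coeff x) + fUp (coeff x) * E s
  (0, 0, fun s => ofMat (fromBlocks 0 (F s) (F s)ᵀ (E s)))

lemma fMat_hMat_ofMat {F E : Mat2} (hE : Eᵀ = E) :
    fMat (ofMat (fromBlocks 0 F Fᵀ E)) = F ∧ hMat (ofMat (fromBlocks 0 F Fᵀ E)) = E := by
  have h_blocks : metric (ofMat (fromBlocks 0 F Fᵀ E)) = fromBlocks 0 F Fᵀ E :=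
    metric_ofMat (by rw [fromBlocks_transpose, transpose_zero, transpose_transpose, hE])
  exact ⟨(fromBlocks_inj.mp h_blocks).2.1, (fromBlocks_inj.mp h_blocks).2.2.2⟩

lemma coeff_add_smul_fibreVector (E : Fin 2 → Mat2) (e : Fin 2 → ℝ) (t : ℝ) :
    coeff (x + t • fibreVector x E e) = coeff x := by
  simp [coeff, fibreVector]

lemma hMat_deriv_add_smul_fibreVector {E : Fin 2 → Mat2} (hE : ∀ s, (E s)ᵀ = E s) (e : Fin 2 → ℝ)
    (t : ℝ) : (fun s => hMat ((x + t • fibreVector x E e).2.2 s)) =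
      (fun s => hMat (x.2.2 s)) + t • E := by
  ext1 s
  change hMat (x.2.2 s) + t • hMat ((fibreVector x E e).2.2 s) = _
  rw [fibreVector, (fMat_hMat_ofMat (hE s)).2]
  rfl

lemma dfUp_add_smul_fibreVector (hx : (hMat (coeff x)).det ≠ 0) {E : Fin 2 → Mat2}
    (hE : ∀ s, (E s)ᵀ = E s) (e : Fin 2 → ℝ) (t : ℝ) (s : Fin 2) :
    dfUp s (x + t • fibreVector x E e) = dfUp s x + t • of ![(s : ℝ) • e, 0] := by
  rw [dfUp, coeff_add_smul_fibreVector]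
  change (fMat (x.2.2 s) + t • fMat ((fibreVector x E e).2.2 s) -
    fUp (coeff x) * (hMat (x.2.2 s) + t • hMat ((fibreVector x E e).2.2 s))) * _ = _
  rw [fibreVector, (fMat_hMat_ofMat (hE s)).1, (fMat_hMat_ofMat (hE s)).2, smul_add,
    Matrix.mul_add, Matrix.mul_smul, add_sub_add_comm, add_sub_cancel_right, Matrix.add_mul,
    Matrix.smul_mul, mul_nonsing_inv_cancel_right _ _ hx.isUnit]
  rfl

lemma ehresmann_add_smul_fibreVector (hx : (hMat (coeff x)).det ≠ 0) {E : Fin 2 → Mat2}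
    (hE : ∀ s, (E s)ᵀ = E s) (e : Fin 2 → ℝ) (t : ℝ) :
    ehresmann (x + t • fibreVector x E e) = ehresmann x + t • e := by
  rw [ehresmann_eq hx, ehresmann_eq (by rwa [coeff_add_smul_fibreVector]),
    dfUp_add_smul_fibreVector hx hE, dfUp_add_smul_fibreVector hx hE]
  ext k
  simp
  ring

lemma fderiv_invariants_fibreVector (hx : x ∈ J1) {E : Fin 2 → Mat2} (hE : ∀ s, (E s)ᵀ = E s)
    {e : Fin 2 → ℝ} {i : Fin 6} {d : ℝ}
    (hd : HasDerivAt (fun t : ℝ => reducedInvariants (orbitMetric (coeff x)) (hMat (coeff x))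
      ((fun s => hMat (x.2.2 s)) + t • E) (ehresmann x + t • e) i) d 0) :
    fderiv ℝ (invariants i) x (fibreVector x E e) = d := by
  have h_smooth := (contDiffAt_invariants (r := 1) hx i).differentiableAt (by simp)
  have h_line : HasDerivAt (fun t : ℝ => invariants i (x + t • fibreVector x E e)) _ 0 :=
    h_smooth.hasFDerivAt.hasLineDerivAt _
  refine h_line.unique (hd.congr_of_eventuallyEq (.of_forall fun t => ?_))
  dsimp only
  rw [invariants_eq, coeff_add_smul_fibreVector, hMat_deriv_add_smul_fibreVector hE,
    ehresmann_add_smul_fibreVector hx.2 hE]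

lemma variation_transpose (ε τ : Fin 2 → ℝ) (s : Fin 2) :
    (variation (hMat (coeff x)) (fun s => hMat (x.2.2 s)) ε τ s)ᵀ =
      variation (hMat (coeff x)) (fun s => hMat (x.2.2 s)) ε τ s := by
  simp only [variation, traceFree, transpose_add, transpose_sub, transpose_smul, hMat_transpose]

theorem functionallyIndependentAt_of_genericity (hx : x ∈ J1)
    (h_gen : genericity (orbitMetric (coeff x)) (hMat (coeff x)) (fun s => hMat (x.2.2 s))
      (ehresmann x) (logDetForm (hMat (coeff x)) fun s => hMat (x.2.2 s))
      (cosgroveForm (hMat (coeff x)) fun s => hMat (x.2.2 s)) ≠ 0) :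
    FunctionallyIndependentAt invariants x := by
  refine Fintype.linearIndependent_iff.mpr fun l hl => ?_
  have h_sum (w : Jet) : ∑ i, l i * fderiv ℝ (invariants i) x w = 0 := by
    simpa using DFunLike.congr_fun hl w
  have hg := det_orbitMetric_ne_zero hx
  obtain ⟨h4, h5⟩ : l 4 = 0 ∧ l 5 = 0 := by
    refine eq_zero_of_curvature_variations hg hx.2 h_gen fun e => ?_
    have h_deriv {i : Fin 6} {d : ℝ} (hd : HasDerivAt (fun t : ℝ => reducedInvariants
        (orbitMetric (coeff x)) (hMat (coeff x)) (fun s => hMat (x.2.2 s))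
          (ehresmann x + t • e) i) d 0) : fderiv ℝ (invariants i) x (fibreVector x 0 e) = d :=
      fderiv_invariants_fibreVector (E := 0) hx (fun _ => transpose_zero)
        (by simpa only [smul_zero, add_zero] using hd)
    have h_eq := h_sum (fibreVector x 0 e)
    simpa only [Fin.sum_univ_six, h_deriv (i := 0) (hasDerivAt_const _ _),
      h_deriv (i := 1) (hasDerivAt_const _ _), h_deriv (i := 2) (hasDerivAt_const _ _),
      h_deriv (i := 3) (hasDerivAt_const _ _),
      h_deriv (hasDerivAt_reducedInvariants_four (hMat_transpose _) e),
      h_deriv (hasDerivAt_reducedInvariants_five e), mul_zero, add_zero, zero_add] using h_eq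
  have h_four : (fun i : Fin 4 => l (i.castAdd 2)) = 0 := by
    refine eq_zero_of_sum_mul_deltaInvariants hg (orbitMetric_transpose _) h_gen fun ε τ => ?_
    have h_deriv (i : Fin 4) := fderiv_invariants_fibreVector (e := 0) hx (variation_transpose ε τ)
      (by simpa only [smul_zero, add_zero] using hasDerivAt_reducedInvariants_variation ε τ hx.2 i)
    have h_eq := h_sum (fibreVector x (variation (hMat (coeff x)) (fun s => hMat (x.2.2 s)) ε τ) 0)
    rw [Fin.sum_univ_add (a := 4) (b := 2)] at h_eq
    simpa [h_deriv, h4, h5] using h_eq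
  intro i
  match i with
  | 0 => exact congrFun h_four 0
  | 1 => exact congrFun h_four 1
  | 2 => exact congrFun h_four 2
  | 3 => exact congrFun h_four 3
  | 4 => exact h4
  | 5 => exact h5

end Fibre

/-! ### Density of the generic jets -/

section Density

variable {n : WithTop ℕ∞} {x : Jet}

/-- The polynomial `det 𝐡 • g̃`. -/
def orbitMetricPoly (x : Jet) : Mat2 :=
  (hMat (coeff x)).det • bMat (coeff x) -
    fMat (coeff x) * adjugate (hMat (coeff x)) * (fMat (coeff x))ᵀ

/-- The polynomial `(det 𝐡)² • D_s (f_i^k)`. -/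
def dfUpPoly (s : Fin 2) (x : Jet) : Mat2 :=
  ((hMat (coeff x)).det • fMat (x.2.2 s) -
    fMat (coeff x) * adjugate (hMat (coeff x)) * hMat (x.2.2 s)) * adjugate (hMat (coeff x))

/-- The polynomial `(det 𝐡)² • γ`. -/
def cosgroveFormPoly (h : Mat2) (k : Fin 2 → Mat2) : Mat2 :=
  of fun i j => h.det * detPolar (k i) (k j) / 2 - detPolar h (k i) * detPolar h (k j) / 4

/-- The condition `genericity` at a jet, multiplied by a power of `det 𝐡` that turns it into a
polynomial on the whole jet space. -/
def genericityPoly (x : Jet) : ℝ :=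
  genericity (orbitMetricPoly x) (hMat (coeff x)) (fun s => hMat (x.2.2 s))
    (dfUpPoly 1 x 0 - dfUpPoly 0 x 1) (fun i => detPolar (hMat (coeff x)) (hMat (x.2.2 i)))
    (cosgroveFormPoly (hMat (coeff x)) fun s => hMat (x.2.2 s))

lemma adjugate_eq_smul_inv {h : Mat2} (hh : h.det ≠ 0) : adjugate h = h.det • h⁻¹ := by
  rw [inv_def, Ring.inverse_eq_inv', smul_smul, mul_inv_cancel₀ hh, one_smul]

lemma orbitMetricPoly_eq (hx : (hMat (coeff x)).det ≠ 0) :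
    orbitMetricPoly x = (hMat (coeff x)).det • orbitMetric (coeff x) := by
  rw [orbitMetricPoly, orbitMetric, adjugate_eq_smul_inv hx, Matrix.mul_smul, Matrix.smul_mul,
    smul_sub]

lemma dfUpPoly_eq (hx : (hMat (coeff x)).det ≠ 0) (s : Fin 2) :
    dfUpPoly s x = (hMat (coeff x)).det ^ 2 • dfUp s x := by
  rw [dfUpPoly, dfUp, fUp, adjugate_eq_smul_inv hx]
  simp only [Matrix.mul_smul, Matrix.smul_mul, ← smul_sub, smul_smul, sq]

lemma cosgroveFormPoly_eq {h : Mat2} (hh : h.det ≠ 0) (k : Fin 2 → Mat2) :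
    cosgroveFormPoly h k = h.det ^ 2 • cosgroveForm h k := by
  ext i j
  simp only [cosgroveFormPoly, cosgroveForm, chiForm, logDetForm, of_apply, Matrix.smul_apply,
    Matrix.sub_apply, vecMulVec_apply, smul_eq_mul]
  field_simp

lemma genericity_ne_zero_of_genericityPoly_ne_zero (hx : (hMat (coeff x)).det ≠ 0)
    (h_poly : genericityPoly x ≠ 0) :
    genericity (orbitMetric (coeff x)) (hMat (coeff x)) (fun s => hMat (x.2.2 s))
      (ehresmann x) (logDetForm (hMat (coeff x)) fun s => hMat (x.2.2 s))
      (cosgroveForm (hMat (coeff x)) fun s => hMat (x.2.2 s)) ≠ 0 := by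
  have h_curv : dfUpPoly 1 x 0 - dfUpPoly 0 x 1 = (hMat (coeff x)).det ^ 2 • ehresmann x := by
    rw [ehresmann_eq hx, dfUpPoly_eq hx, dfUpPoly_eq hx, smul_sub]
    rfl
  have h_logDet : (fun i => detPolar (hMat (coeff x)) (hMat (x.2.2 i))) =
      (hMat (coeff x)).det • logDetForm (hMat (coeff x)) fun s => hMat (x.2.2 s) :=
    funext fun i => (mul_div_cancel₀ _ hx).symm
  rw [genericityPoly, orbitMetricPoly_eq hx, h_curv, h_logDet, cosgroveFormPoly_eq hx,
    genericity_smul] at h_poly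
  exact right_ne_zero_of_mul h_poly

lemma contDiff_adjugate_fin_two : ContDiff ℝ n (adjugate : Mat2 → Mat2) := by
  refine contDiff_iff_contDiffAt.mpr fun m => ?_
  have h_entry (i j : Fin 2) : ContDiffAt ℝ n (fun m : Mat2 => m i j) m :=
    (contDiff_matrix_apply i j).contDiffAt
  have h_eq : (adjugate : Mat2 → Mat2) = fun m => of ![![m 1 1, -m 0 1], ![-m 1 0, m 0 0]] :=
    funext adjugate_fin_two
  rw [h_eq]
  refine contDiffAt_matrix_of fun i j => ?_
  fin_cases i <;> fin_cases j
  exacts [h_entry 1 1, (h_entry 0 1).neg, (h_entry 1 0).neg, h_entry 0 0]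

lemma contDiffAt_genericity {E : Type*} [NormedAddCommGroup E] [NormedSpace ℝ E]
    {g h γ : E → Mat2} {k : E → Fin 2 → Mat2} {c σ : E → Fin 2 → ℝ} {y : E}
    (hg : ContDiffAt ℝ n g y) (hh : ContDiffAt ℝ n h y) (hk : ContDiffAt ℝ n k y)
    (hc : ContDiffAt ℝ n c y) (hσ : ContDiffAt ℝ n σ y) (hγ : ContDiffAt ℝ n γ y) :
    ContDiffAt ℝ n (fun y => genericity (g y) (h y) (k y) (c y) (σ y) (γ y)) y := by
  have h_entry {m : E → Mat2} (hm : ContDiffAt ℝ n m y) (i j : Fin 2) :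
      ContDiffAt ℝ n (fun y => m y i j) y :=
    (contDiff_matrix_apply i j).contDiffAt.comp y hm
  have h_mulVec {u : E → Fin 2 → ℝ} (hu : ContDiffAt ℝ n u y) (s : Fin 2) :
      ContDiffAt ℝ n (fun y => k y s *ᵥ u y) y :=
    contDiffAt_mulVec (contDiffAt_pi.mp hk s) hu
  have h_adj {m : E → Mat2} (hm : ContDiffAt ℝ n m y) :
      ContDiffAt ℝ n (fun y => adjugate (m y) *ᵥ σ y) y :=
    contDiffAt_mulVec (contDiff_adjugate_fin_two.contDiffAt.comp y hm) hσ
  have hhc := contDiffAt_mulVec hh hc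
  have h_orth : ContDiffAt ℝ n (fun y => ![-(h y *ᵥ c y) 1, (h y *ᵥ c y) 0]) y := by
    refine contDiffAt_pi.mpr fun i => ?_
    fin_cases i
    exacts [(contDiffAt_pi.mp hhc 1).neg, contDiffAt_pi.mp hhc 0]
  have h_ell : ContDiffAt ℝ n (fun y => c y ⬝ᵥ h y *ᵥ c y) y :=
    ContDiffAt.sum fun i _ => (contDiffAt_pi.mp hc i).mul (contDiffAt_pi.mp hhc i)
  have h_polar := (contDiffAt_cross (h_mulVec h_orth 0) (h_mulVec hc 1)).add
    (contDiffAt_cross (h_mulVec hc 0) (h_mulVec h_orth 1))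
  have h_diag := ((h_entry hγ 0 0).mul (h_entry hg 1 1)).sub
    ((h_entry hγ 1 1).mul (h_entry hg 0 0))
  exact ((((h_ell.mul (contDiffAt_cross (h_mulVec hc 0) (h_mulVec hc 1))).mul h_polar).mul
    (contDiffAt_cross (h_adj hg) (h_adj hγ))).mul h_diag).mul
      (contDiff_matrix_det.contDiffAt.comp y hγ)

lemma contDiff_genericityPoly : ContDiff ℝ n genericityPoly := by
  have hb : ContDiff ℝ n fun x => bMat (coeff x) := bMatL.contDiff.comp contDiff_coeff
  have hf : ContDiff ℝ n fun x => fMat (coeff x) := fMatL.contDiff.comp contDiff_coeff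
  have hh : ContDiff ℝ n fun x => hMat (coeff x) := hMatL.contDiff.comp contDiff_coeff
  have hk : ContDiff ℝ n fun (x : Jet) s => hMat (x.2.2 s) := contDiff_hMat_deriv
  have h_det : ContDiff ℝ n fun x => (hMat (coeff x)).det := contDiff_matrix_det.comp hh
  have h_adj : ContDiff ℝ n fun x => adjugate (hMat (coeff x)) :=
    contDiff_adjugate_fin_two.comp hh
  have h_dfUp (s : Fin 2) : ContDiff ℝ n (dfUpPoly s) := by
    have hfs : ContDiff ℝ n fun x : Jet => fMat (x.2.2 s) :=
      fMatL.contDiff.comp (contDiff_pi.mp contDiff_snd.snd s)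
    exact ((h_det.smul hfs).sub ((hf.mul h_adj).mul (contDiff_pi.mp hk s))).mul h_adj
  have h_row (s i : Fin 2) : ContDiff ℝ n fun x => dfUpPoly s x i :=
    contDiff_pi.mpr fun j => (contDiff_matrix_apply i j).comp (h_dfUp s)
  have h_polar (i j : Fin 2) {x : Jet} :
      ContDiffAt ℝ n (fun x : Jet => detPolar (hMat (x.2.2 i)) (hMat (x.2.2 j))) x :=
    contDiffAt_detPolar (contDiff_pi.mp hk i).contDiffAt (contDiff_pi.mp hk j).contDiffAt
  have h_logDet (i : Fin 2) {x : Jet} :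
      ContDiffAt ℝ n (fun x : Jet => detPolar (hMat (coeff x)) (hMat (x.2.2 i))) x :=
    contDiffAt_detPolar hh.contDiffAt (contDiff_pi.mp hk i).contDiffAt
  refine contDiff_iff_contDiffAt.mpr fun x => contDiffAt_genericity ?_ hh.contDiffAt hk.contDiffAt
    ((h_row 1 0).sub (h_row 0 1)).contDiffAt (contDiffAt_pi.mpr fun i => h_logDet i) ?_
  · exact ((h_det.smul hb).sub
      ((hf.mul h_adj).mul (contDiff_matrix_transpose.comp hf))).contDiffAt
  · exact contDiffAt_matrix_of fun i j =>
      ((h_det.contDiffAt.mul (h_polar i j)).div_const 2).sub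
        (((h_logDet i).mul (h_logDet j)).div_const 4)

lemma exists_genericityPoly_ne_zero : ∃ x, genericityPoly x ≠ 0 := by
  let y : Coeff := ofMat (fromBlocks 0 0 0ᵀ !![0, 0; 0, 1])
  let z : Coeff := ofMat (fromBlocks 0 !![0, 1; 0, 0] !![0, 1; 0, 0]ᵀ !![1, 1; 1, 0])
  have h_one : metric (ofMat 1) = fromBlocks 1 0 0 1 := by
    rw [metric_ofMat transpose_one, fromBlocks_one]
  obtain ⟨hb, hf, -, hh⟩ := fromBlocks_inj.mp h_one
  obtain ⟨hyf, hyh⟩ : fMat y = 0 ∧ hMat y = !![0, 0; 0, 1] :=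
    fMat_hMat_ofMat (by ext i j; fin_cases i <;> fin_cases j <;> rfl)
  obtain ⟨hzf, hzh⟩ : fMat z = !![0, 1; 0, 0] ∧ hMat z = !![1, 1; 1, 0] :=
    fMat_hMat_ofMat (by ext i j; fin_cases i <;> fin_cases j <;> rfl)
  refine ⟨(0, ofMat 1, ![y, z]), ?_⟩
  simp [genericityPoly, genericity, orbitMetricPoly, dfUpPoly, cosgroveFormPoly, coeff, hb, hf, hh,
    hyf, hyh, hzf, hzh, detPolar_eq, cross, mulVec, dotProduct, det_fin_two, adjugate_fin_two]
  norm_num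

lemma dense_ne_zero_of_contDiff_omega {E : Type*} [NormedAddCommGroup E] [NormedSpace ℝ E]
    {f : E → ℝ} (hf : ContDiff ℝ ω f) (h_ne : ∃ y, f y ≠ 0) : Dense {x | f x ≠ 0} := by
  obtain ⟨y, hy⟩ := h_ne
  intro x
  rw [mem_closure_iff_frequently]
  refine fun h_zero => hy ?_
  have h_eventually : f =ᶠ[nhds x] fun _ => 0 := h_zero.mono fun _ hz => not_not.mp hz
  exact congrFun ((contDiff_omega_iff_analyticOnNhd.mp hf).eq_of_eventuallyEq
    (fun _ _ => analyticAt_const) h_eventually) y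

lemma dense_genericityPoly_ne_zero : Dense {x | genericityPoly x ≠ 0} :=
  dense_ne_zero_of_contDiff_omega contDiff_genericityPoly exists_genericityPoly_ne_zero

end Density

/-! ### Conclusion -/

lemma isOpen_setOf_functionallyIndependentAt {m : ℕ} {F : Fin m → Jet → ℝ} {U : Set Jet}
    (hU : IsOpen U) (hF : ∀ i, ContDiffOn ℝ ∞ (F i) U) :
    IsOpen (U ∩ {x | FunctionallyIndependentAt F x}) := by
  have h_cont : ContinuousOn (fun x i => fderiv ℝ (F i) x) U :=
    continuousOn_pi.mpr fun i => (hF i).continuousOn_fderiv_of_isOpen hU (by simp)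
  exact h_cont.isOpen_inter_preimage hU isOpen_setOfPred_linearIndependent

lemma isOpen_intransitiveJ1 : IsOpen intransitiveJ1 := by
  have h_cont : ContinuousOn ehresmann J1 := fun x hx =>
    (contDiffAt_ehresmann (n := 0) hx.2).continuousAt.continuousWithinAt
  exact h_cont.isOpen_inter_preimage isOpen_J1 isOpen_ne

lemma IsInvariant.mono {U V : Set Jet} {F : Jet → ℝ} (hF : IsInvariant V F) (h_sub : U ⊆ V) :
    IsInvariant U F :=
  ⟨hF.smooth.mono h_sub, fun P W s s' hP hT p hp h h' =>
    hF.invariant P W s s' hP hT p hp (h_sub h) (h_sub h')⟩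

theorem genericallyIndependentOn_invariants :
    GenericallyIndependentOn invariants intransitiveJ1 := by
  have h_open : IsOpen {x | genericityPoly x ≠ 0} :=
    isOpen_ne.preimage (contDiff_genericityPoly (n := 0)).continuous
  exact ⟨intransitiveJ1 ∩ {x | genericityPoly x ≠ 0}, isOpen_intransitiveJ1.inter h_open,
    Set.inter_subset_left,
    dense_genericityPoly_ne_zero.open_subset_closure_inter isOpen_intransitiveJ1,
    fun _ hx => functionallyIndependentAt_of_genericity hx.1.1
      (genericity_ne_zero_of_genericityPoly_ne_zero hx.1.1.2 hx.2)⟩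

theorem not_functionallyIndependentAt_snoc {U : Set Jet} (hU : IsOpen U) (hJ : U ⊆ J1)
    {F : Jet → ℝ} (hF : IsInvariant U F) {x : Jet} (hx : x ∈ U) :
    ¬ FunctionallyIndependentAt (Fin.snoc invariants F : Fin 7 → Jet → ℝ) x := by
  intro h_indep
  have h_inv : ∀ i, IsInvariant U ((Fin.snoc invariants F : Fin 7 → Jet → ℝ) i) := by
    refine Fin.lastCases (by rwa [Fin.snoc_last]) fun i => ?_
    rw [Fin.snoc_castSucc]
    exact (isInvariant_invariants i).mono hJ
  -- Independence is an open condition, so it may be tested at a generic jet near `x`.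
  obtain ⟨y, ⟨hy, hy_indep⟩, hy_poly⟩ := dense_genericityPoly_ne_zero.inter_open_nonempty _
    (isOpen_setOf_functionallyIndependentAt hU fun i => (h_inv i).smooth) ⟨x, hx, h_indep⟩
  have h_gen := genericity_ne_zero_of_genericityPoly_ne_zero (hJ hy).2 hy_poly
  simp only [genericity, mul_ne_zero_iff] at h_gen
  obtain ⟨⟨⟨⟨⟨-, h_theta⟩, -⟩, -⟩, -⟩, -⟩ := h_gen
  exact not_functionallyIndependentAt_of_cross_ne_zero hU hJ h_inv hy h_theta hy_indep

end KillingJet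

end

/-- In the orthogonally intransitive case, `C_ρ, C_χ, Q_χ, Q_γ, ℓ_𝒞, (Θ_I)²` form a maximal system
of generically functionally independent first-order scalar differential invariants. -/
theorem mainTheorem4 :
    (∀ i, KillingJet.IsInvariant KillingJet.J1 (KillingJet.invariants i)) ∧
    KillingJet.GenericallyIndependentOn KillingJet.invariants KillingJet.intransitiveJ1 ∧
    (∀ (U : Set KillingJet.Jet) (F : KillingJet.Jet → ℝ),
      IsOpen U → U ⊆ KillingJet.J1 → KillingJet.IsInvariant U F →
      ∀ x ∈ U, ¬ KillingJet.FunctionallyIndependentAt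
        (Fin.snoc KillingJet.invariants F : Fin 7 → KillingJet.Jet → ℝ) x) :=
  ⟨KillingJet.isInvariant_invariants, KillingJet.genericallyIndependentOn_invariants,
    fun _ _ hU hJ hF _ hx => KillingJet.not_functionallyIndependentAt_snoc hU hJ hF hx⟩
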